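/- \textbf{Conventions.} An Ore domain is a domain satisfying the left and the right Ore condition; $\mathrm{Frac}\,A$ denotes its skew field of fractions and $Z(A)$ its centre. For a field $K$ let $A_n(K)$ be the $n$-th Weyl algebra over $K$ (generators $x_1,\dots,x_n,y_1,\dots,y_n$, relations $[x_i,x_j]=[y_i,y_j]=0$, $[y_i,x_j]=\delta_{ij}$), and for a field $k$ let $\mathbb D_{n,l}(k)$ be the skew field of fractions of $A_n(k(t_1,\dots,t_l))$. For a $k$-algebra $A$ let $$\mathrm{Tdeg}\,A=\sup_V\inf_b\limsup_{n\to\infty}\frac{\log\dim_k (k+bV)^n}{\log n}$$ be the Gelfand--Kirillov transcendence degree, where $V$ ranges over the finite-dimensional subspaces of $A$ and $b$ over the regular elements of $A$; $\mathrm{tdeg}$ is the usual transcendence degree over $k$. \textbf{Definition.} A family $\mathcal K=\{A_k\}$ of $k$-algebras, indexed by all algebraically closed fields $k$ (of any characteristic), is \emph{$\mathbb Z$-compatible} if: (1) there is a ring $A_{\mathbb Z}$ with $A_k=A_{\mathbb Z}\otimes_{\mathbb Z}k$ for all $k$; (2) $A_{\mathbb Z}$ and all $A_k$ are Ore domains;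 (3) there is a finitely generated $\mathbb Z$-submodule $V\subseteq A_{\mathbb Z}$ such that the modules $A_i^{\mathbb Z}=(\mathbb Z+V)^i$, $i\ge 0$ (so $A_0^{\mathbb Z}=\mathbb Z$ and $A_i^{\mathbb Z}=(A_1^{\mathbb Z})^i$), are free over $\mathbb Z$ and form an exhaustive filtration of $A_{\mathbb Z}$, and for every $k$ and $i$ the natural map $A_i^{\mathbb Z}\otimes_{\mathbb Z} k\to A_k$ is injective, so that the $A_i^k=A_i^{\mathbb Z}\otimes_{\mathbb Z} k$ are a finite-dimensional filtration of $A_k$; (4) $Z(\mathrm{Frac}\,A_k)\cong\mathrm{Frac}\,Z(A_k)$ as $k$-algebras if $\mathrm{char}\,k=0$; (5) $\mathrm{Tdeg}\,\mathrm{Frac}\,A_k=\dim_k (V\otimes_{\mathbb Z}k)$ for all $k$; (6) there are $x_1,\dots,x_s\in A_{\mathbb Z}$ such that, for every $k$ of characteristic $0$, $Z(A_k)$ is the polynomial algebra $k[x_1,\dots,x_s]$, and for every algebraically closed $\mathbb F$ of prime characteristic the images of the $x_i$ in $A_{\mathbb F}$ lie in $Z(A_{\mathbb F})$. For $k$ algebraically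 closed of characteristic $0$, the \emph{Gelfand--Kirillov Conjecture holds for $A_k$} if $\mathrm{Frac}\,A_k\cong\mathbb D_{n,l}(k)$ as $k$-algebras for some $n,l\ge 0$ with $\mathrm{Tdeg}\,\mathrm{Frac}\,A_k=2n+l$ and $l=\mathrm{tdeg}\,\mathrm{Frac}\,Z(A_k)$. \textbf{Theorem.} Let $\mathcal K=\{A_k\}$ be a $\mathbb Z$-compatible family of algebras. There is a first-order sentence $\phi_{\mathcal K}$ in the language of rings $(0,1,+,*)$, which is the existential closure of a boolean combination of atomic formulas, such that the following are equivalent: (1) for some algebraically closed field $k$ of characteristic $0$, the Gelfand--Kirillov Conjecture holds for $A_k$; (2) for every algebraically closed field $k$ of characteristic $0$, the Gelfand--Kirillov Conjecture holds for $A_k$; (3) $ACF_0\vdash\phi_{\mathcal K}$. -/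

import Mathlib

universe u v

open scoped TensorProduct

noncomputable section

namespace ZCompat

/-! ### Ore domains and their skew fields of fractions -/

/-- A (two-sided) Ore domain: a domain in which any two elements, one of them nonzero, have a
common left multiple and a common right multiple of the usual kind. -/
structure IsOreDomain (A : Type*) [Ring A] : Prop where
  isDomain : IsDomain A
  left : ∀ a b : A, b ≠ 0 → ∃ c d : A, d ≠ 0 ∧ d * a = c * b
  right : ∀ a b : A, b ≠ 0 → ∃ c d : A, d ≠ 0 ∧ a * d = b * c

/-- The nonzero elements of an Ore domain form an Ore set in the sense of Mathlib. -/
@[reducible]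
def IsOreDomain.oreSet {A : Type*} [Ring A] (h : IsOreDomain A) :
    OreLocalization.OreSet (nonZeroDivisors A) :=
  haveI := h.isDomain
  have key : ∀ (a : A) (s : nonZeroDivisors A), ∃ p : A × nonZeroDivisors A,
      (p.2 : A) * a = p.1 * (s : A) := fun a s => by
    obtain ⟨c, d, hd, e⟩ := h.left a s (nonZeroDivisors.coe_ne_zero s)
    exact ⟨(c, ⟨d, mem_nonZeroDivisors_of_ne_zero hd⟩), e⟩
  { ore_right_cancel := fun r₁ r₂ s hs =>
      ⟨1, by rw [mul_right_cancel₀ (nonZeroDivisors.coe_ne_zero s) hs]⟩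
    oreNum := fun a s => (key a s).choose.1
    oreDenom := fun a s => (key a s).choose.2
    ore_eq := fun a s => (key a s).choose_spec }

/-- `Frac A`, the skew field of fractions `b⁻¹ a` of an Ore domain `A`: the Ore localization of `A`
at its nonzero elements, with Mathlib's ring and algebra structures. -/
abbrev SkewFrac (A : Type*) [Ring A] (h : IsOreDomain A) : Type _ :=
  letI := h.oreSet
  OreLocalization (nonZeroDivisors A) A

/-- The ring `Frac A` is a division ring. -/
@[reducible]
def IsOreDomain.divisionRing {A : Type*} [Ring A] (h : IsOreDomain A) :
    DivisionRing (SkewFrac A h) :=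
  letI := h.oreSet
  haveI := h.isDomain
  inferInstance

/-- `f : R → D` exhibits the skew field `D` as a skew field of fractions of `R`: it is injective
and every element of `D` is a fraction `f(b)⁻¹ f(a)`. Such a `D` is unique up to isomorphism. -/
structure IsSkewFieldOfFractions {R D : Type*} [Ring R] [DivisionRing D] (f : R →+* D) :
    Prop where
  injective : Function.Injective f
  exists_fraction : ∀ d : D, ∃ a b : R, b ≠ 0 ∧ d = (f b)⁻¹ * f a

/-! ### Weyl algebras and Weyl fields -/

/-- The defining relations of the `n`-th Weyl algebra; `Sum.inl i` is the index of `x_i` and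
`Sum.inr i` that of `y_i`. -/
inductive WeylRel (K : Type*) [CommRing K] (n : ℕ) :
    FreeAlgebra K (Fin n ⊕ Fin n) → FreeAlgebra K (Fin n ⊕ Fin n) → Prop
  | xx (i j : Fin n) : WeylRel K n
      (FreeAlgebra.ι K (Sum.inl i) * FreeAlgebra.ι K (Sum.inl j) -
        FreeAlgebra.ι K (Sum.inl j) * FreeAlgebra.ι K (Sum.inl i)) 0
  | yy (i j : Fin n) : WeylRel K n
      (FreeAlgebra.ι K (Sum.inr i) * FreeAlgebra.ι K (Sum.inr j) -
        FreeAlgebra.ι K (Sum.inr j) * FreeAlgebra.ι K (Sum.inr i)) 0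
  | yx (i j : Fin n) : WeylRel K n
      (FreeAlgebra.ι K (Sum.inr i) * FreeAlgebra.ι K (Sum.inl j) -
        FreeAlgebra.ι K (Sum.inl j) * FreeAlgebra.ι K (Sum.inr i)) (if i = j then 1 else 0)

/-- The `n`-th Weyl algebra `A_n(K)`. -/
abbrev WeylAlgebra (K : Type*) [CommRing K] (n : ℕ) : Type _ := RingQuot (WeylRel K n)

/-- The field `k(t_1, …, t_l)` of rational functions. -/
abbrev RatFunField (k : Type*) [Field k] (l : ℕ) : Type _ := FractionRing (MvPolynomial (Fin l) k)

/-- The algebra `A_{n,l}(k) = A_n(k(t_1, …, t_l))`, which is regarded as a `k`-algebra. -/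
abbrev WeylAlgebraOver (k : Type*) [Field k] (n l : ℕ) : Type _ := WeylAlgebra (RatFunField k l) n

/-- `B ≅ 𝔻_{n,l}(k)` as `k`-algebras, where `𝔻_{n,l}(k)` is the skew field of fractions of
`A_{n,l}(k)`. -/
def IsoWeylField (k : Type u) [Field k] (n l : ℕ) (B : Type*) [Ring B] [Algebra k B] : Prop :=
  ∃ (D : Type u) (_ : DivisionRing D) (_ : Algebra k D) (f : WeylAlgebraOver k n l →ₐ[k] D),
    IsSkewFieldOfFractions (f : WeylAlgebraOver k n l →+* D) ∧ Nonempty (B ≃ₐ[k] D)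

/-! ### The Gelfand–Kirillov transcendence degree -/

/-- The growth exponent `limsup_n log (dim_k Wⁿ) / log n` of a finite-dimensional subspace `W`. -/
def growth (k : Type*) [Field k] {A : Type*} [Ring A] [Algebra k A] (W : Submodule k A) : EReal :=
  Filter.limsup (fun n : ℕ =>
    ((Real.log (Module.finrank k (W ^ n : Submodule k A)) / Real.log n : ℝ) : EReal)) Filter.atTop

/-- The Gelfand–Kirillov transcendence degree
`Tdeg A = sup_V inf_b limsup_n log (dim_k (k + bV)ⁿ) / log n`, with `V` ranging over the
finite-dimensional subspaces of `A` and `b` over its regular elements. -/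
def Tdeg (k : Type*) [Field k] (A : Type*) [Ring A] [Algebra k A] : EReal :=
  ⨆ (V : Submodule k A) (_ : FiniteDimensional k V), ⨅ (b : A) (_ : b ∈ nonZeroDivisors A),
    growth k (1 ⊔ V.map (LinearMap.mulLeft k b))

/-! ### `ℤ`-compatible families -/

/-- The filtration `A_0 = ℤ`, `A_i = A_1 ^ i` with `A_1 = ℤ + V`. It is increasing and
multiplicative. -/
def filtr {AZ : Type*} [Ring AZ] (V : Submodule ℤ AZ) (i : ℕ) : Submodule ℤ AZ := (1 ⊔ V) ^ i

/-- The ring `AZ` defines a `ℤ`-compatible family `A_k = k ⊗ AZ`, `k` running over all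
algebraically closed fields. The module `gens` is the degree-one generating module of the
filtration, and its rank is the number that the transcendence degree has to equal. It may or may
not contain `1`: the choice `gens = A_1` is allowed, and so is `gens = 𝔤` for `U(𝔤)` with
`A_1 = ℤ + 𝔤`. -/
structure ZCompatible (AZ : Type v) [Ring AZ] where
  /-- Ore conditions. -/
  oreDomain : ∀ (k : Type u) [Field k] [IsAlgClosed k], IsOreDomain (k ⊗[ℤ] AZ)
  oreDomain_int : IsOreDomain AZ
  /-- The filtration of `AZ`, which is exhaustive and by finitely generated free modules. -/
  gens : Submodule ℤ AZ
  gens_fg : gens.FG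
  exhaustive : ⨆ i, filtr gens i = ⊤
  filtr_free : ∀ i, Module.Free ℤ (filtr gens i)
  /-- `k ⊗ A_i` is a subspace of `A_k`. -/
  filtr_baseChange : ∀ (k : Type u) [Field k] [IsAlgClosed k] (i : ℕ),
    Function.Injective ((filtr gens i).subtype.baseChange k)
  /-- `Z(Frac A_k) ≅ Frac Z(A_k)` in characteristic zero. -/
  center_frac : ∀ (k : Type u) [Field k] [IsAlgClosed k] [CharZero k],
    Nonempty (Subalgebra.center k (SkewFrac (k ⊗[ℤ] AZ) (oreDomain k)) ≃ₐ[k]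
      FractionRing (Subalgebra.center k (k ⊗[ℤ] AZ)))
  /-- The transcendence degree of `Frac A_k`. -/
  tdeg_eq : ∀ (k : Type u) [Field k] [IsAlgClosed k],
    Tdeg k (SkewFrac (k ⊗[ℤ] AZ) (oreDomain k)) = (Module.finrank k (k ⊗[ℤ] gens) : EReal)
  /-- The centre is a polynomial algebra on elements `x_1, …, x_s` of `AZ`. -/
  s : ℕ
  x : Fin s → AZ
  center_poly : ∀ (k : Type u) [Field k] [IsAlgClosed k] [CharZero k],
    ∃ e : MvPolynomial (Fin s) k ≃ₐ[k] Subalgebra.center k (k ⊗[ℤ] AZ),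
      ∀ i, (e (MvPolynomial.X i) : k ⊗[ℤ] AZ) = 1 ⊗ₜ[ℤ] x i
  center_modular : ∀ (F : Type u) [Field F] [IsAlgClosed F] (p : ℕ), p.Prime → CharP F p →
    ∀ i, (1 ⊗ₜ[ℤ] x i : F ⊗[ℤ] AZ) ∈ Subalgebra.center F (F ⊗[ℤ] AZ)

/-- The Gelfand–Kirillov Conjecture holds for the Ore domain `A` over `k`: `Frac A ≅ 𝔻_{n,l}(k)`
where `Tdeg Frac A = 2n + l` and `l` is the transcendence degree of `Frac Z(A)` over `k`. -/
def GelfandKirillovHolds (k : Type u) [Field k] (A : Type*) [Ring A] [Algebra k A]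
    (h : IsOreDomain A) : Prop :=
  ∃ n l : ℕ, Tdeg k (SkewFrac A h) = ((2 * n + l : ℕ) : EReal) ∧
    Algebra.trdeg k (FractionRing (Subalgebra.center k A)) = (l : Cardinal) ∧
    IsoWeylField k n l (SkewFrac A h)

/-! ### The language `(0, 1, +, *)` -/

/-- The function symbols `0, 1, +, *`. -/
inductive ArithFunc : ℕ → Type
  | zero : ArithFunc 0
  | one : ArithFunc 0
  | add : ArithFunc 2
  | mul : ArithFunc 2

/-- The language `(0, 1, +, *)`. -/
def arithLang : FirstOrder.Language := ⟨ArithFunc, fun _ => Empty⟩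

/-- The inclusion of `(0, 1, +, *)` into Mathlib's language of rings, which also has a symbol for
negation and in which Mathlib states the theory of algebraically closed fields. -/
def arithToRing : arithLang.LHom FirstOrder.Language.ring where
  onFunction := fun _ f => match f with
    | .zero => FirstOrder.ringFunc.zero
    | .one => FirstOrder.ringFunc.one
    | .add => FirstOrder.ringFunc.add
    | .mul => FirstOrder.ringFunc.mul
  onRelation := fun _ r => Empty.elim r

end ZCompat

end

/-!
If `Frac A_k` is a Weyl skew field, it contains finitely many elements `X`, `Y`, `T` which satisfy
the Weyl relations, such that the generators of `A_ℤ` are left fractions of polynomials in `X`, `Y`,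
`T` and the central elements `x_i` are algebraic over `T`. All of this is witnessed by finitely many
equations and inequations over `k`, so it persists over every algebraically closed field of
characteristic zero in which a suitable finite piece of the diagram of `k` has a solution: the
homomorphism from `A_k` to germs of families of fractions along the finite pieces of the diagram
extends to `Frac A_k`, because a nonzero element of `A_k`, written in a `ℤ`-basis of a layer of
`A_ℤ`, has a nonzero coefficient and therefore becomes invertible.

Conversely such `X`, `Y`, `T` yield an isomorphism with the Weyl skew field. In characteristic zero
the Weyl algebra is simple, by an Euler operator, and satisfies the Ore condition, by polynomial
growth; and the `s` elements `T` are algebraically independent, because the `s` independent elements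
`x_i` are algebraic over them.

The sentence says that this finite piece of the diagram has a solution, and completeness of `ACF_0`
does the rest; if the conjecture fails over every `k`, the sentence is `⊥`.
-/

noncomputable section

namespace ZCompat

attribute [local instance] LieRing.ofAssociativeRing

/-! ### The filtration generated by a subspace -/

section Layer

variable {R B : Type*} [CommRing R] [Ring B] [Algebra R B]

/-- The `N`-th layer `(R + V) ^ N` of the filtration of an algebra generated by a submodule `V`.
For `R = ℤ` this is `filtr`. -/
def layer (V : Submodule R B) (N : ℕ) : Submodule R B := (1 ⊔ V) ^ N

/-- The layer below the `N`-th one, which is zero for `N = 0`. -/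
def lowerLayer (V : Submodule R B) : ℕ → Submodule R B
  | 0 => ⊥
  | N + 1 => layer V N

variable {V : Submodule R B} {s : Set B} {N N' : ℕ} {w w' : B}

theorem mem_layer_zero : w ∈ layer V 0 ↔ ∃ c : R, algebraMap R B c = w := by
  rw [layer, pow_zero, Submodule.mem_one]

theorem layer_mono (h : N ≤ N') : layer V N ≤ layer V N' := pow_le_pow_right' le_sup_left h

theorem le_layer_one : V ≤ layer V 1 := by
  rw [layer, pow_one]
  exact le_sup_right

theorem mul_mem_layer (hw : w ∈ layer V N) (hw' : w' ∈ layer V N') :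
    w * w' ∈ layer V (N + N') := by
  rw [layer, pow_add]
  exact Submodule.mul_mem_mul hw hw'

theorem mul_mem_layer_succ (hw : w ∈ V) (hw' : w' ∈ layer V N) : w * w' ∈ layer V (N + 1) :=
  add_comm N 1 ▸ mul_mem_layer (le_layer_one hw) hw'

theorem layer_span_succ_le {P : Submodule R B} (hP : layer (.span R s) N ≤ P)
    (hs : ∀ g ∈ s, ∀ w ∈ layer (.span R s) N, g * w ∈ P) : layer (.span R s) (N + 1) ≤ P := by
  rw [layer, pow_succ', Submodule.sup_mul, one_mul]
  refine sup_le hP (Submodule.mul_le.2 fun g hg w hw => ?_)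
  have : Submodule.span R s ≤ P.comap (LinearMap.mulRight R w) :=
    Submodule.span_le.2 fun g hg => hs g hg w hw
  exact this hg

theorem layer_le_adjoin : layer (.span R s) N ≤ Subalgebra.toSubmodule (Algebra.adjoin R s) := by
  induction N with
  | zero =>
    intro w hw
    obtain ⟨c, rfl⟩ := mem_layer_zero.1 hw
    exact Subalgebra.algebraMap_mem _ c
  | succ N ih =>
    exact layer_span_succ_le ih fun g hg w hw =>
      Subalgebra.mul_mem _ (Algebra.subset_adjoin hg) (ih hw)

theorem exists_mem_layer_of_mem_adjoin (hw : w ∈ Algebra.adjoin R s) :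
    ∃ N, w ∈ layer (.span R s) N := by
  induction hw using Algebra.adjoin_induction with
  | mem w hw => exact ⟨1, le_layer_one (Submodule.subset_span hw)⟩
  | algebraMap c => exact ⟨0, mem_layer_zero.2 ⟨c, rfl⟩⟩
  | add w w' _ _ hw hw' =>
    obtain ⟨N, hN⟩ := hw
    obtain ⟨N', hN'⟩ := hw'
    exact ⟨N + N', add_mem (layer_mono (Nat.le_add_right _ _) hN)
      (layer_mono (Nat.le_add_left _ _) hN')⟩
  | mul w w' _ _ hw hw' =>
    obtain ⟨N, hN⟩ := hw
    obtain ⟨N', hN'⟩ := hw'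
    exact ⟨N + N', mul_mem_layer hN hN'⟩

theorem lowerLayer_le_layer : lowerLayer V N ≤ layer V N := by
  cases N with
  | zero => exact bot_le
  | succ N => exact layer_mono N.le_succ

theorem mul_mem_layer_of_mem_lowerLayer (hw : w ∈ V) (hw' : w' ∈ lowerLayer V N) :
    w * w' ∈ layer V N := by
  cases N with
  | zero => simp [(Submodule.mem_bot R).1 hw']
  | succ N => exact mul_mem_layer_succ hw hw'

theorem lie_mul (z a b : B) : ⁅z, a * b⁆ = ⁅z, a⁆ * b + a * ⁅z, b⁆ := by
  simp only [Ring.lie_def]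
  noncomm_ring

theorem mul_mem_of_mem_one {P : Submodule R B} (hw : w ∈ (1 : Submodule R B)) (hw' : w' ∈ P) :
    w * w' ∈ P := by
  obtain ⟨c, rfl⟩ := Submodule.mem_one.1 hw
  rw [← Algebra.smul_def]
  exact P.smul_mem c hw'

theorem lie_mem_lowerLayer {z : B} (hz : ∀ g ∈ s, ⁅z, g⁆ ∈ (1 : Submodule R B))
    (hw : w ∈ layer (.span R s) N) : ⁅z, w⁆ ∈ lowerLayer (.span R s) N := by
  induction N generalizing w with
  | zero =>
    obtain ⟨c, rfl⟩ := mem_layer_zero.1 hw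
    rw [Ring.lie_def, Algebra.commutes, sub_self]
    exact zero_mem _
  | succ N ih =>
    have h : layer (.span R s) (N + 1) ≤
        (layer (.span R s) N).comap (LieAlgebra.ad R B z : B →ₗ[R] B) := by
      refine layer_span_succ_le (fun w hw => lowerLayer_le_layer (ih hw)) fun g hg w hw => ?_
      rw [Submodule.mem_comap, LieAlgebra.ad_apply, lie_mul]
      exact add_mem (mul_mem_of_mem_one (hz g hg) hw)
        (mul_mem_layer_of_mem_lowerLayer (Submodule.subset_span hg) (ih hw))
    exact h hw

end Layer

/-! ### Simplicity of Weyl algebras -/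

section Euler

variable (R : Type*) {B σ : Type*} [CommRing R] [Ring B] [Algebra R B] [DecidableEq σ]

/-- The members of `z` commute up to scalars, and bracketing with the members of `z'` acts on `z`
as the partial derivatives. -/
structure IsDualFamily (z z' : σ → B) : Prop where
  lie_mem_one : ∀ a b, ⁅z a, z b⁆ ∈ (1 : Submodule R B)
  lie_dual : ∀ a b, ⁅z' a, z b⁆ = if a = b then 1 else 0

/-- The analogue of the Euler operator `∑ z_a ∂/∂z_a`, with `⁅z' a, ·⁆` in the role of
`∂/∂z_a`. -/
def euler [Fintype σ] (z z' : σ → B) : B →ₗ[R] B :=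
  ∑ a, LinearMap.mulLeft R (z a) ∘ₗ (LieAlgebra.ad R B (z' a) : B →ₗ[R] B)

variable {R}

omit [DecidableEq σ] in
theorem euler_apply [Fintype σ] (z z' : σ → B) (w : B) : euler R z z' w = ∑ a, z a * ⁅z' a, w⁆ := by
  simp [euler]

namespace IsDualFamily

variable {z z' : σ → B} (h : IsDualFamily R z z') {N : ℕ} {w : B}
include h

theorem lie_dual_mem_lowerLayer (a : σ) (hw : w ∈ layer (.span R (Set.range z)) N) :
    ⁅z' a, w⁆ ∈ lowerLayer (.span R (Set.range z)) N := by
  refine lie_mem_lowerLayer ?_ hw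
  rintro _ ⟨b, rfl⟩
  rw [h.lie_dual]
  split_ifs
  · exact Submodule.one_le.1 le_rfl
  · exact zero_mem _

theorem euler_mul [Fintype σ] (c : σ) (w : B) :
    euler R z z' (z c * w) =
      z c * w + z c * euler R z z' w + ∑ a, ⁅z a, z c⁆ * ⁅z' a, w⁆ := by
  have summand (a : σ) : z a * ⁅z' a, z c * w⁆ =
      (if a = c then z a * w else 0) + z c * (z a * ⁅z' a, w⁆) + ⁅z a, z c⁆ * ⁅z' a, w⁆ := by
    rw [lie_mul, h.lie_dual, Ring.lie_def (z a) (z c)]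
    split_ifs <;> noncomm_ring
  simp only [euler_apply, summand, Finset.sum_add_distrib, Finset.sum_ite_eq', Finset.mem_univ,
    if_true, Finset.mul_sum]

theorem euler_sub_nsmul_mem [Fintype σ] (hw : w ∈ layer (.span R (Set.range z)) N) :
    euler R z z' w - N • w ∈ lowerLayer (.span R (Set.range z)) N := by
  induction N generalizing w with
  | zero =>
    have hzero (a : σ) : ⁅z' a, w⁆ = 0 := (Submodule.mem_bot R).1 (h.lie_dual_mem_lowerLayer a hw)
    simp [euler_apply, hzero]
  | succ N ih =>
    suffices layer (.span R (Set.range z)) (N + 1) ≤ (layer (.span R (Set.range z)) N).comap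
        (euler R z z' - (N + 1) • LinearMap.id) from this hw
    refine layer_span_succ_le (fun w hw => ?_) ?_
    · have : euler R z z' w - (N + 1) • w = (euler R z z' w - N • w) - w := by
        rw [add_smul, one_smul]
        abel
      rw [Submodule.mem_comap, LinearMap.sub_apply, LinearMap.smul_apply, LinearMap.id_apply, this]
      exact sub_mem (lowerLayer_le_layer (ih hw)) hw
    · rintro _ ⟨c, rfl⟩ w hw
      have : euler R z z' (z c * w) - (N + 1) • (z c * w) =
          z c * (euler R z z' w - N • w) + ∑ a, ⁅z a, z c⁆ * ⁅z' a, w⁆ := by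
        rw [h.euler_mul, add_smul, one_smul, mul_sub, mul_smul_comm]
        abel
      rw [Submodule.mem_comap, LinearMap.sub_apply, LinearMap.smul_apply, LinearMap.id_apply, this]
      exact add_mem
        (mul_mem_layer_of_mem_lowerLayer (Submodule.subset_span ⟨c, rfl⟩) (ih hw))
        (sum_mem fun a _ => mul_mem_of_mem_one (h.lie_mem_one a c)
          (lowerLayer_le_layer (h.lie_dual_mem_lowerLayer a hw)))

end IsDualFamily

-- A kernel element of least degree is killed by all `⁅z' a, ·⁆`, hence by the Euler operator, which
-- modulo lower layers multiplies it by its degree.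
theorem IsDualFamily.injOn_adjoin [Finite σ] {K : Type*} [Field K] [CharZero K] [Algebra K B]
    {C : Type*} [Ring C] [Algebra K C] [Nontrivial C] {z z' : σ → B} (h : IsDualFamily K z z')
    (g : B →ₐ[K] C) : Set.InjOn g (Algebra.adjoin K (Set.range z)) := by
  have := Fintype.ofFinite σ
  have ker_layer (N : ℕ) : ∀ w ∈ layer (.span K (Set.range z)) N, g w = 0 → w = 0 := by
    induction N with
    | zero =>
      intro w hw hg
      obtain ⟨c, rfl⟩ := mem_layer_zero.1 hw
      rw [AlgHom.commutes, FaithfulSMul.algebraMap_eq_zero_iff] at hg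
      rw [hg, map_zero]
    | succ N ih =>
      intro w hw hg
      have lie_zero (a : σ) : ⁅z' a, w⁆ = 0 :=
        ih _ (h.lie_dual_mem_lowerLayer a hw) (by simp [Ring.lie_def, hg])
      have hN : (N + 1) • w ∈ layer (.span K (Set.range z)) N := by
        have := h.euler_sub_nsmul_mem hw
        rwa [euler_apply, Finset.sum_eq_zero fun a _ => by rw [lie_zero, mul_zero], zero_sub,
          neg_mem_iff] at this
      rw [← Nat.cast_smul_eq_nsmul K,
        Submodule.smul_mem_iff _ (Nat.cast_ne_zero.2 N.succ_ne_zero)] at hN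
      exact ih w hN hg
  intro w hw w' hw' hg
  obtain ⟨N, hN⟩ := exists_mem_layer_of_mem_adjoin (sub_mem hw hw')
  exact sub_eq_zero.1 (ker_layer N _ hN (by rw [map_sub, hg, sub_self]))

end Euler

/-! ### Growth -/

section Growth

theorem mul_pow_le_pow_mul_pow {S : Type*} [IdemSemiring S] {a b : S} (h : b * a ≤ a * b)
    (N : ℕ) : (a * b) ^ N ≤ a ^ N * b ^ N := by
  have pow_mul_le (N : ℕ) : b ^ N * a ≤ a * b ^ N := by
    induction N with
    | zero => simp
    | succ N ih =>
      calc b ^ (N + 1) * a = b ^ N * (b * a) := by rw [pow_succ, mul_assoc]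
        _ ≤ b ^ N * (a * b) := by gcongr
        _ = b ^ N * a * b := (mul_assoc ..).symm
        _ ≤ a * b ^ N * b := by gcongr
        _ = a * b ^ (N + 1) := by rw [pow_succ, mul_assoc]
  induction N with
  | zero => simp
  | succ N ih =>
    calc (a * b) ^ (N + 1) = (a * b) ^ N * (a * b) := pow_succ ..
      _ ≤ a ^ N * b ^ N * (a * b) := by gcongr
      _ = a ^ N * (b ^ N * a) * b := by simp only [mul_assoc]
      _ ≤ a ^ N * (a * b ^ N) * b := by exact mul_le_mul_left (mul_le_mul_right (pow_mul_le N) _) _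
      _ = a ^ (N + 1) * b ^ (N + 1) := by simp only [pow_succ, mul_assoc]

variable {K B : Type*} [Field K] [Ring B] [Algebra K B]

theorem finrank_mul_le (U W : Submodule K B) [FiniteDimensional K U] [FiniteDimensional K W] :
    Module.finrank K (U * W : Submodule K B) ≤ Module.finrank K U * Module.finrank K W := by
  rw [← Submodule.mulMap_range, ← Module.finrank_tensorProduct (R := K)]
  exact LinearMap.finrank_range_le _

theorem finiteDimensional_layer (V : Submodule K B) [FiniteDimensional K V] (N : ℕ) :
    FiniteDimensional K (layer V N) := by
  have : (1 ⊔ V).FG := by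
    rw [Submodule.one_eq_span]
    exact (Submodule.fg_span_singleton 1).sup (Module.Finite.iff_fg.1 inferInstance)
  exact Module.Finite.iff_fg.2 (this.pow N)

theorem finrank_layer_span_singleton_le (z : B) (N : ℕ) :
    Module.finrank K (layer (K ∙ z) N) ≤ N + 1 := by
  have h : layer (K ∙ z) N ≤ .span K (Set.range fun j : Fin (N + 1) => z ^ (j : ℕ)) := by
    induction N with
    | zero =>
      intro w hw
      obtain ⟨c, rfl⟩ := mem_layer_zero.1 hw
      rw [Algebra.algebraMap_eq_smul_one]
      exact Submodule.smul_mem _ c (Submodule.subset_span ⟨0, by simp⟩)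
    | succ N ih =>
      refine layer_span_succ_le (ih.trans (Submodule.span_mono ?_)) ?_
      · rintro _ ⟨j, rfl⟩
        exact ⟨j.castSucc, rfl⟩
      · intro g hg w hw
        rw [Set.mem_singleton_iff.1 hg]
        have hspan : Submodule.span K (Set.range fun j : Fin (N + 1) => z ^ (j : ℕ)) ≤
            (Submodule.span K (Set.range fun j : Fin (N + 2) => z ^ (j : ℕ))).comap
              (LinearMap.mulLeft K z) := by
          rw [Submodule.span_le]
          rintro _ ⟨j, rfl⟩
          exact Submodule.subset_span ⟨j.succ, by simp [pow_succ']⟩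
        exact hspan (ih hw)
  have := Module.Finite.span_of_finite K (Set.finite_range fun j : Fin (N + 1) => z ^ (j : ℕ))
  calc Module.finrank K (layer (K ∙ z) N) ≤ _ := Submodule.finrank_mono h
    _ ≤ Fintype.card (Fin (N + 1)) := finrank_range_le_card _
    _ = N + 1 := Fintype.card_fin _

theorem layer_span_insert_le {z : B} {s : Set B} (h : ∀ g ∈ s, ⁅z, g⁆ ∈ (1 : Submodule K B))
    (N : ℕ) : layer (.span K (insert z s)) N ≤ layer (K ∙ z) N * layer (.span K s) N := by
  set U : Submodule K B := 1 ⊔ K ∙ z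
  set W : Submodule K B := 1 ⊔ .span K s
  have one_le_U : 1 ≤ U := le_sup_left
  have one_le_W : 1 ≤ W := le_sup_left
  have swap : W * U ≤ U * W := by
    have span_mul : Submodule.span K s * (K ∙ z) ≤ U * W := by
      rw [Submodule.span_mul_span, Submodule.span_le]
      rintro _ ⟨g, hg, z', hz', rfl⟩
      rw [Set.mem_singleton_iff.1 hz']
      have hUW : z * g ∈ U * W := Submodule.mul_mem_mul
        (Submodule.mem_sup_right (Submodule.mem_span_singleton_self z))
        (Submodule.mem_sup_right (Submodule.subset_span hg))
      have hone : ⁅z, g⁆ ∈ U * W := one_le_mul one_le_U one_le_W (h g hg)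
      simpa [Ring.lie_def] using sub_mem hUW hone
    rw [Submodule.sup_mul, one_mul, Submodule.mul_sup, mul_one]
    refine sup_le (le_mul_of_one_le_right' one_le_W) (sup_le ?_ span_mul)
    exact le_sup_right.trans (le_mul_of_one_le_left' one_le_U)
  have insert_le : 1 ⊔ .span K (insert z s) ≤ U * W := by
    rw [Submodule.span_insert]
    refine sup_le (one_le_mul one_le_U one_le_W) (sup_le ?_ ?_)
    · exact le_sup_right.trans (le_mul_of_one_le_right' one_le_W)
    · exact le_sup_right.trans (le_mul_of_one_le_left' one_le_U)
  exact (pow_le_pow_left' insert_le N).trans (mul_pow_le_pow_mul_pow swap N)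

theorem finrank_layer_span_insert_le {z : B} {s : Set B} (hs : s.Finite)
    (h : ∀ g ∈ s, ⁅z, g⁆ ∈ (1 : Submodule K B)) (N : ℕ) :
    Module.finrank K (layer (.span K (insert z s)) N) ≤
      (N + 1) * Module.finrank K (layer (.span K s) N) := by
  have := Module.Finite.span_of_finite K hs
  have := finiteDimensional_layer (K ∙ z) N
  have := finiteDimensional_layer (.span K s) N
  have : FiniteDimensional K (layer (K ∙ z) N * layer (.span K s) N : Submodule K B) :=
    Module.Finite.iff_fg.2
      ((Module.Finite.iff_fg.1 inferInstance).mul (Module.Finite.iff_fg.1 inferInstance))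
  calc Module.finrank K (layer (.span K (insert z s)) N)
      ≤ Module.finrank K (layer (K ∙ z) N * layer (.span K s) N : Submodule K B) :=
        Submodule.finrank_mono (layer_span_insert_le h N)
    _ ≤ Module.finrank K (layer (K ∙ z) N) * Module.finrank K (layer (.span K s) N) :=
        finrank_mul_le _ _
    _ ≤ (N + 1) * Module.finrank K (layer (.span K s) N) :=
        Nat.mul_le_mul_right _ (finrank_layer_span_singleton_le z N)

theorem finrank_layer_span_le (s : Finset B)
    (h : ∀ z ∈ s, ∀ g ∈ s, ⁅z, g⁆ ∈ (1 : Submodule K B)) (N : ℕ) :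
    Module.finrank K (layer (.span K (s : Set B)) N) ≤ (N + 1) ^ s.card := by
  classical
  induction s using Finset.induction_on with
  | empty =>
    rw [Finset.coe_empty, Submodule.span_empty, layer, sup_bot_eq, one_pow, Finset.card_empty,
      pow_zero, Submodule.one_eq_span]
    exact (finrank_span_le_card {1}).trans (by simp)
  | insert z s hz ih =>
    rw [Finset.coe_insert, Finset.card_insert_of_notMem hz, pow_succ']
    refine (finrank_layer_span_insert_le s.finite_toSet (fun g hg => ?_) N).trans
      (Nat.mul_le_mul_left _ (ih fun a ha b hb => ?_))
    · exact h z (Finset.mem_insert_self z s) g (Finset.mem_insert_of_mem hg)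
    · exact h a (Finset.mem_insert_of_mem ha) b (Finset.mem_insert_of_mem hb)

end Growth

/-! ### The Ore condition -/

section Ore

theorem exists_pow_lt_two_pow (M e : ℕ) : ∃ j : ℕ, (j * M + 1) ^ e < 2 ^ j := by
  have hlim := tendsto_pow_const_div_const_pow_of_one_lt e (show (1 : ℝ) < 2 by norm_num)
  have hpos : (0 : ℝ) < 1 / ((M + 1 : ℝ) ^ e) := by positivity
  obtain ⟨j, hj, hj1⟩ := ((hlim.eventually (gt_mem_nhds hpos)).and
    (Filter.eventually_ge_atTop 1)).exists
  rw [div_lt_div_iff₀ (by positivity) (by positivity), one_mul, ← mul_pow] at hj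
  refine ⟨j, lt_of_le_of_lt (Nat.pow_le_pow_left ?_ e) (by exact_mod_cast hj)⟩
  exact (Nat.add_le_add_left hj1 _).trans_eq (Nat.mul_succ j M).symm

variable {K B : Type*} [Field K] [Ring B] [IsDomain B] [Algebra K B] {V : Submodule K B}
  [FiniteDimensional K V] {a b : B} {M : ℕ}

theorem two_mul_finrank_layer_le (ha : a ∈ layer V M) (hb : b ∈ layer V M) (hb0 : b ≠ 0)
    (hab : ∀ N, ∀ d ∈ layer V N, ∀ c ∈ layer V N, d * a = c * b → d = 0) (N : ℕ) :
    2 * Module.finrank K (layer V N) ≤ Module.finrank K (layer V (N + M)) := by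
  let F : (layer V N × layer V N) →ₗ[K] layer V (N + M) :=
    LinearMap.codRestrict _ (((LinearMap.mulRight K a).comp (layer V N).subtype).coprod
      ((LinearMap.mulRight K b).comp (layer V N).subtype))
      fun p => add_mem (mul_mem_layer p.1.2 ha) (mul_mem_layer p.2.2 hb)
  have injective_F : Function.Injective F := by
    refine (injective_iff_map_eq_zero F).2 fun ⟨d, c⟩ hdc => ?_
    have hsum : (d : B) * a + c * b = 0 := congrArg Subtype.val hdc
    have hd : (d : B) = 0 := hab N d d.2 (-c) (neg_mem c.2)
      (by rw [neg_mul]; exact eq_neg_of_add_eq_zero_left hsum)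
    rw [hd, zero_mul, zero_add] at hsum
    ext
    · exact hd
    · exact (mul_eq_zero.1 hsum).resolve_right hb0
  have := finiteDimensional_layer V N
  have := finiteDimensional_layer V (N + M)
  have := LinearMap.finrank_le_finrank_of_injective injective_F
  rwa [Module.finrank_prod, ← two_mul] at this

theorem two_pow_le_finrank_layer (ha : a ∈ layer V M) (hb : b ∈ layer V M) (hb0 : b ≠ 0)
    (hab : ∀ N, ∀ d ∈ layer V N, ∀ c ∈ layer V N, d * a = c * b → d = 0) (j : ℕ) :
    2 ^ j ≤ Module.finrank K (layer V (j * M)) := by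
  induction j with
  | zero =>
    have := finiteDimensional_layer V (0 * M)
    rw [pow_zero, Nat.one_le_iff_ne_zero, Ne, Submodule.finrank_eq_zero, ← Ne,
      Submodule.ne_bot_iff, zero_mul]
    exact ⟨1, mem_layer_zero.2 ⟨1, map_one _⟩, one_ne_zero⟩
  | succ j ih =>
    rw [pow_succ', add_mul, one_mul]
    exact (Nat.mul_le_mul_left 2 ih).trans (two_mul_finrank_layer_le ha hb hb0 hab _)

-- Without a common left multiple the sum of `layer N * a` and `layer N * b` is direct, so the
-- layers grow exponentially.
omit [FiniteDimensional K V] in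
theorem exists_left_ore_of_lie_mem_one {s : Set B} (hs : s.Finite)
    (hlie : ∀ z ∈ s, ∀ g ∈ s, ⁅z, g⁆ ∈ (1 : Submodule K B)) (ha : a ∈ Algebra.adjoin K s)
    (hb : b ∈ Algebra.adjoin K s) (hb0 : b ≠ 0) :
    ∃ c ∈ Algebra.adjoin K s, ∃ d ∈ Algebra.adjoin K s, d ≠ 0 ∧ d * a = c * b := by
  lift s to Finset B using hs
  obtain ⟨N, haN⟩ := exists_mem_layer_of_mem_adjoin ha
  obtain ⟨N', hbN'⟩ := exists_mem_layer_of_mem_adjoin hb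
  by_contra! hcon
  obtain ⟨j, hj⟩ := exists_pow_lt_two_pow (N + N') s.card
  have two_pow_le := two_pow_le_finrank_layer (layer_mono (Nat.le_add_right N N') haN)
    (layer_mono (Nat.le_add_left N' N) hbN') hb0 (fun N d hd c hc hdc => by
      by_contra hd0
      exact hcon c (layer_le_adjoin hc) d (layer_le_adjoin hd) hd0 hdc) j
  exact absurd (two_pow_le.trans (finrank_layer_span_le s hlie _)) hj.not_ge

end Ore

/-! ### Germs along a filter -/

section Germ

variable {ι : Type*} (l : Filter ι) (F : ι → Type*) [∀ i, Ring (F i)]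

/-- The congruence on sections of a family of rings that identifies two sections when they agree
eventually along the filter `l`. -/
def germCon : RingCon (∀ i, F i) where
  r f g := ∀ᶠ i in l, f i = g i
  iseqv :=
    ⟨fun _ => .of_forall fun _ => rfl, fun h => h.mono fun _ e => e.symm,
      fun h h' => (h.and h').mono fun _ e => e.1.trans e.2⟩
  add' h h' := (h.and h').mono fun _ e => congrArg₂ (· + ·) e.1 e.2
  mul' h h' := (h.and h').mono fun _ e => congrArg₂ (· * ·) e.1 e.2

/-- The ring of germs along `l` of sections of a family of rings. -/
def GermRing : Type _ := (germCon l F).Quotient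

instance : Ring (GermRing l F) := inferInstanceAs (Ring (germCon l F).Quotient)

variable {F}

/-- The germ of a section. -/
def germ : (∀ i, F i) →+* GermRing l F := (germCon l F).mk'

variable {l}

theorem germ_eq_germ_iff {f g : ∀ i, F i} : germ l f = germ l g ↔ ∀ᶠ i in l, f i = g i :=
  RingCon.eq (germCon l F)

theorem germ_surjective : Function.Surjective (germ l : (∀ i, F i) →+* GermRing l F) :=
  RingCon.mk'_surjective (germCon l F)

variable {D : Type*} [Ring D] (θ : D →+* GermRing l F) (x y : D)

/-- A section whose germ is `θ x`. The choice is immaterial, since only its eventual behaviour is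
used. -/
def spread : ∀ i, F i := Function.surjInv germ_surjective (θ x)

theorem germ_spread : germ l (spread θ x) = θ x := Function.surjInv_eq germ_surjective (θ x)

variable {x} in
theorem eventually_spread_eq_iff {f : ∀ i, F i} :
    (∀ᶠ i in l, spread θ x i = f i) ↔ θ x = germ l f := by
  rw [← germ_spread θ x, germ_eq_germ_iff]

theorem eventually_spread_add : ∀ᶠ i in l, spread θ (x + y) i = spread θ x i + spread θ y i :=
  (eventually_spread_eq_iff θ (f := spread θ x + spread θ y)).2 <| by
    simp only [map_add, germ_spread]

theorem eventually_spread_mul : ∀ᶠ i in l, spread θ (x * y) i = spread θ x i * spread θ y i :=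
  (eventually_spread_eq_iff θ (f := spread θ x * spread θ y)).2 <| by
    simp only [map_mul, germ_spread]

theorem eventually_spread_sub : ∀ᶠ i in l, spread θ (x - y) i = spread θ x i - spread θ y i :=
  (eventually_spread_eq_iff θ (f := spread θ x - spread θ y)).2 <| by
    simp only [map_sub, germ_spread]

theorem eventually_spread_zero : ∀ᶠ i in l, spread θ (0 : D) i = 0 :=
  (eventually_spread_eq_iff θ (f := 0)).2 <| by simp only [map_zero]

theorem eventually_spread_one : ∀ᶠ i in l, spread θ (1 : D) i = 1 :=
  (eventually_spread_eq_iff θ (f := 1)).2 <| by simp only [map_one]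

theorem eventually_spread_sum_mul_pow {N : ℕ} (c : Fin N → D) :
    ∀ᶠ i in l, spread θ (∑ m, c m * x ^ (m : ℕ)) i =
      ∑ m, spread θ (c m) i * spread θ x i ^ (m : ℕ) := by
  refine (eventually_spread_eq_iff θ
    (f := fun i => ∑ m, spread θ (c m) i * spread θ x i ^ (m : ℕ))).2 ?_
  have : (fun i => ∑ m, spread θ (c m) i * spread θ x i ^ (m : ℕ)) =
      ∑ m, spread θ (c m) * spread θ x ^ (m : ℕ) := by
    ext i; simp only [Finset.sum_apply, Pi.mul_apply, Pi.pow_apply]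
  simp only [this, map_sum, map_mul, map_pow, germ_spread]

end Germ

section GermDivisionRing

variable {ι : Type*} {l : Filter ι} {F : ι → Type*} [∀ i, DivisionRing (F i)]

theorem isUnit_germ {f : ∀ i, F i} (h : ∀ᶠ i in l, f i ≠ 0) : IsUnit (germ l f) := by
  refine ⟨⟨germ l f, germ l fun i => (f i)⁻¹, ?_, ?_⟩, rfl⟩
  all_goals rw [← map_mul, ← map_one (germ l), germ_eq_germ_iff]
  · exact h.mono fun i hi => mul_inv_cancel₀ hi
  · exact h.mono fun i hi => inv_mul_cancel₀ hi

theorem eventually_spread_ne_zero {D : Type*} [DivisionRing D] (θ : D →+* GermRing l F) {x : D}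
    (hx : x ≠ 0) : ∀ᶠ i in l, spread θ x i ≠ 0 := by
  filter_upwards [eventually_spread_mul θ x x⁻¹, eventually_spread_one θ] with i hmul hone hzero
  rw [mul_inv_cancel₀ hx, hone, hzero, zero_mul] at hmul
  exact one_ne_zero hmul

end GermDivisionRing

/-! ### The diagram of a field -/

/-- The literals with parameters in `k` that make up its diagram: `1 = 1`, where the first `1` is
the parameter and the second one the constant symbol, `a + b = c` and `a * b = c` with the
parameter `c` named by its value in `k`, and `a ≠ 0`. -/
inductive Literal (k : Type u) : Type u
  | one : Literal k
  | add (a b : k) : Literal k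
  | mul (a b : k) : Literal k
  | ne (a : k) : Literal k

/-- The truth of a literal after its parameters have been replaced along `c`. -/
def Literal.Holds {k : Type u} [Field k] {k' : Type*} [Field k'] (c : k → k') : Literal k → Prop
  | .one => c 1 = 1
  | .add a b => c (a + b) = c a + c b
  | .mul a b => c (a * b) = c a * c b
  | .ne a => c a ≠ 0

/-- An algebraically closed field of characteristic zero with an interpretation of the parameters
from `k`, which need not respect the operations. -/
structure Point (k : Type u) : Type (u + 1) where
  carrier : Type u
  [field : Field carrier]
  [isAlgClosed : IsAlgClosed carrier]
  [charZero : CharZero carrier]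
  map : k → carrier

attribute [instance] Point.field Point.isAlgClosed Point.charZero

/-- The filter on the points generated by the finite pieces of the diagram of `k`. -/
def diagramFilter (k : Type u) [Field k] : Filter (Point k) :=
  ⨅ L : {L : Literal k // L.Holds (id : k → k)}, .principal {p | L.1.Holds p.map}

section Diagram

variable {k : Type u} [Field k]

theorem eventually_holds {L : Literal k} (h : L.Holds (id : k → k)) :
    ∀ᶠ p in diagramFilter k, L.Holds p.map :=
  Filter.mem_iInf_of_mem ⟨L, h⟩ (Filter.mem_principal_self _)

theorem eventually_map_one : ∀ᶠ p in diagramFilter k, p.map 1 = 1 :=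
  eventually_holds (L := .one) rfl

theorem eventually_map_add (a b : k) :
    ∀ᶠ p in diagramFilter k, p.map (a + b) = p.map a + p.map b :=
  eventually_holds (L := .add a b) rfl

theorem eventually_map_mul (a b : k) :
    ∀ᶠ p in diagramFilter k, p.map (a * b) = p.map a * p.map b :=
  eventually_holds (L := .mul a b) rfl

theorem eventually_map_ne_zero {a : k} (ha : a ≠ 0) : ∀ᶠ p in diagramFilter k, p.map a ≠ 0 :=
  eventually_holds (L := .ne a) ha

theorem eventually_map_zero : ∀ᶠ p in diagramFilter k, p.map 0 = 0 := by
  filter_upwards [eventually_map_add (0 : k) 0] with p hp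
  simpa using hp

theorem exists_finite_literals_of_eventually {P : Point k → Prop}
    (h : ∀ᶠ p in diagramFilter k, P p) :
    ∃ S : Set (Literal k), S.Finite ∧ (∀ L ∈ S, L.Holds (id : k → k)) ∧
      ∀ p : Point k, (∀ L ∈ S, L.Holds p.map) → P p := by
  obtain ⟨S, hS, hSP⟩ := (Filter.hasBasis_iInf_principal_finite _).mem_iff.1 h
  refine ⟨Subtype.val '' S, hS.image _, ?_, fun p hp => hSP <| Set.mem_iInter₂.2 fun L hL => ?_⟩
  · rintro _ ⟨L, -, rfl⟩
    exact L.2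
  · exact hp L (Set.mem_image_of_mem _ hL)

end Diagram

/-! ### Skew fields of fractions -/

section SkewFrac

variable {A : Type*} [Ring A] (h : IsOreDomain A)

/-- The inclusion of an Ore domain into its skew field of fractions. -/
def toSkewFrac : A →+* SkewFrac A h :=
  letI := h.oreSet
  OreLocalization.numeratorRingHom

theorem toSkewFrac_injective : Function.Injective (toSkewFrac h) := by
  let _ := h.oreSet
  have := h.isDomain
  exact OreLocalization.numeratorHom_inj fun _ hx => hx.1

theorem toSkewFrac_algebraMap {k : Type*} [CommRing k] [Algebra k A] (c : k) :
    toSkewFrac h (algebraMap k A c) = algebraMap k (SkewFrac A h) c := rfl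

theorem exists_toSkewFrac_mul_eq (d : SkewFrac A h) :
    ∃ a b : A, b ≠ 0 ∧ toSkewFrac h b * d = toSkewFrac h a := by
  let _ := h.oreSet
  have := h.isDomain
  induction d using OreLocalization.ind with
  | _ r s => exact ⟨r, s, nonZeroDivisors.coe_ne_zero s, OreLocalization.mul_cancel⟩

theorem exists_skewFrac_lift {R : Type*} [Ring R] (f : A →+* R)
    (hf : ∀ a, a ≠ 0 → IsUnit (f a)) :
    ∃ g : SkewFrac A h →+* R, ∀ a, g (toSkewFrac h a) = f a := by
  let _ := h.oreSet
  have := h.isDomain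
  choose w hw using fun s : nonZeroDivisors A => hf s (nonZeroDivisors.coe_ne_zero s)
  let unitOf : nonZeroDivisors A →* Rˣ :=
    { toFun := w
      map_one' := Units.ext (by rw [hw, OneMemClass.coe_one, map_one, Units.val_one])
      map_mul' := fun a b => Units.ext (by
        rw [Units.val_mul, hw, hw, hw, Submonoid.coe_mul, map_mul]) }
  exact ⟨OreLocalization.universalHom f unitOf fun s => (hw s).symm,
    fun a => OreLocalization.universalHom_commutes f unitOf _⟩

end SkewFrac

/-! ### Spreading out fractions over a `ℤ`-compatible family -/

namespace ZCompatible

variable {AZ : Type v} [Ring AZ] (Z : ZCompatible.{u, v} AZ)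

theorem filtr_mono : Monotone (filtr Z.gens) := fun _ _ => layer_mono

theorem exists_mem_filtr (a : AZ) : ∃ i, a ∈ filtr Z.gens i := by
  have : a ∈ ⨆ i, filtr Z.gens i := Z.exhaustive ▸ Submodule.mem_top
  rwa [Submodule.mem_iSup_of_directed _ Z.filtr_mono.directed_le] at this

section Fraction

variable (k : Type u) [Field k] [IsAlgClosed k]

/-- The skew field `Frac A_k`. It is a definition and not an abbreviation so that its division
ring and algebra structures are found as instances. -/
def Fraction : Type _ := SkewFrac (k ⊗[ℤ] AZ) (Z.oreDomain k)

instance : DivisionRing (Z.Fraction k) := (Z.oreDomain k).divisionRing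

instance : Algebra k (Z.Fraction k) :=
  inferInstanceAs (Algebra k (SkewFrac (k ⊗[ℤ] AZ) (Z.oreDomain k)))

/-- The identification of `SkewFrac` with its irreducible copy `Fraction`. -/
def fractionEquiv : SkewFrac (k ⊗[ℤ] AZ) (Z.oreDomain k) ≃ₐ[k] Z.Fraction k := AlgEquiv.refl

/-- The inclusion of `A_k` into `Frac A_k`. -/
def incl : k ⊗[ℤ] AZ →ₐ[k] Z.Fraction k :=
  { toSkewFrac (Z.oreDomain k) with commutes' := toSkewFrac_algebraMap _ }

theorem incl_injective : Function.Injective (Z.incl k) := toSkewFrac_injective (Z.oreDomain k)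

variable {k} in
theorem exists_incl_mul_eq (d : Z.Fraction k) :
    ∃ a b : k ⊗[ℤ] AZ, b ≠ 0 ∧ Z.incl k b * d = Z.incl k a :=
  exists_toSkewFrac_mul_eq (Z.oreDomain k) d

/-- The map from `A_ℤ` to `Frac A_k`. -/
def toFraction : AZ →+* Z.Fraction k :=
  (Z.incl k : k ⊗[ℤ] AZ →+* Z.Fraction k).comp
    (Algebra.TensorProduct.includeRight : AZ →ₐ[ℤ] k ⊗[ℤ] AZ).toRingHom

theorem toFraction_apply (a : AZ) : Z.toFraction k a = Z.incl k (1 ⊗ₜ a) := rfl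

variable {k} in
theorem incl_tmul (c : k) (a : AZ) :
    Z.incl k (c ⊗ₜ a) = algebraMap k _ c * Z.toFraction k a := by
  rw [toFraction_apply, ← Algebra.smul_def, ← map_smul, TensorProduct.smul_tmul', smul_eq_mul,
    mul_one]

end Fraction

section Expansion

variable {k : Type u} [Field k]

theorem exists_mem_baseChange_filtr (w : k ⊗[ℤ] AZ) : ∃ i, w ∈ (filtr Z.gens i).baseChange k := by
  induction w with
  | zero => exact ⟨0, zero_mem _⟩
  | tmul c a =>
    obtain ⟨i, hi⟩ := Z.exists_mem_filtr a
    exact ⟨i, Submodule.tmul_mem_baseChange_of_mem c hi⟩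
  | add w₁ w₂ h₁ h₂ =>
    obtain ⟨i, hi⟩ := h₁
    obtain ⟨j, hj⟩ := h₂
    exact ⟨max i j, add_mem (Submodule.baseChange_mono k (Z.filtr_mono (le_max_left i j)) hi)
      (Submodule.baseChange_mono k (Z.filtr_mono (le_max_right i j)) hj)⟩

theorem linearIndependent_tmul_basis [IsAlgClosed k] {J : Type*} {i : ℕ}
    (b : Module.Basis J ℤ (filtr Z.gens i)) :
    LinearIndependent k fun j => (1 : k) ⊗ₜ[ℤ] (b j : AZ) := by
  have baseChange_comp :
      (filtr Z.gens i).subtype.baseChange k ∘ b.baseChange k = fun j => 1 ⊗ₜ (b j : AZ) := by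
    ext j
    rw [Function.comp_apply, Module.Basis.baseChange_apply, LinearMap.baseChange_tmul,
      Submodule.subtype_apply]
  exact baseChange_comp ▸ (b.baseChange k).linearIndependent.map' _
    (LinearMap.ker_eq_bot.2 (Z.filtr_baseChange k i))

include Z in
theorem exists_mem_span_tmul (w : k ⊗[ℤ] AZ) :
    ∃ (J : Type v) (b : J → AZ),
      w ∈ Submodule.span k (Set.range fun j => (1 : k) ⊗ₜ[ℤ] b j) ∧
      ∀ (k' : Type u) [Field k'] [IsAlgClosed k'],
        LinearIndependent k' fun j => (1 : k') ⊗ₜ[ℤ] b j := by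
  obtain ⟨i, hi⟩ := Z.exists_mem_baseChange_filtr w
  have := Z.filtr_free i
  let b := Module.Free.chooseBasis ℤ (filtr Z.gens i)
  refine ⟨_, fun j => b j, ?_, fun k' _ _ => Z.linearIndependent_tmul_basis b⟩
  have span_b : Submodule.span ℤ (Set.range fun j => (b j : AZ)) = filtr Z.gens i := by
    rw [Set.range_comp' Subtype.val b, ← Submodule.coe_subtype, Submodule.span_image, b.span_eq,
      Submodule.map_subtype_top]
  rwa [← span_b, Submodule.baseChange_span, ← Set.range_comp] at hi

end Expansion

section FractionGerm

variable (k : Type u) [Field k]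

/-- The ring of germs of families of fractions along the diagram of `k`. -/
abbrev FractionGerm : Type _ :=
  GermRing (diagramFilter k) fun p : Point k => Z.Fraction p.carrier

/-- The germ of constant fractions defined by a scalar. -/
def scalarGerm : k →+* Z.FractionGerm k where
  toFun a := germ _ fun p => algebraMap p.carrier _ (p.map a)
  map_one' := by
    rw [← map_one (germ _), germ_eq_germ_iff]
    filter_upwards [eventually_map_one (k := k)] with p hp
    rw [hp, map_one, Pi.one_apply]
  map_zero' := by
    rw [← map_zero (germ _), germ_eq_germ_iff]
    filter_upwards [eventually_map_zero (k := k)] with p hp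
    rw [hp, map_zero, Pi.zero_apply]
  map_add' a b := by
    rw [← map_add (germ _), germ_eq_germ_iff]
    filter_upwards [eventually_map_add a b] with p hp
    rw [hp, map_add, Pi.add_apply]
  map_mul' a b := by
    rw [← map_mul (germ _), germ_eq_germ_iff]
    filter_upwards [eventually_map_mul a b] with p hp
    rw [hp, map_mul, Pi.mul_apply]

/-- The germ of fractions defined by an element of `A_ℤ`. -/
def integralGerm : AZ →+* Z.FractionGerm k :=
  (germ _).comp (RingHom.pi fun p : Point k => Z.toFraction p.carrier)

variable {k} in
theorem commute_scalarGerm_integralGerm (c : k) (a : AZ) :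
    Commute (Z.scalarGerm k c) (Z.integralGerm k a) := by
  change germ _ _ * germ _ _ = germ _ _ * germ _ _
  rw [← map_mul, ← map_mul, germ_eq_germ_iff]
  exact .of_forall fun p => Algebra.commutes (p.map c) (Z.toFraction p.carrier a)

/-- The germ of fractions defined by an element of `A_k`. -/
def elementGerm : k ⊗[ℤ] AZ →+* Z.FractionGerm k :=
  (Algebra.TensorProduct.lift (Z.scalarGerm k).toIntAlgHom (Z.integralGerm k).toIntAlgHom
    Z.commute_scalarGerm_integralGerm).toRingHom

variable {k}

theorem elementGerm_tmul (c : k) (a : AZ) :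
    Z.elementGerm k (c ⊗ₜ a) = germ _ fun p : Point k => Z.incl p.carrier (p.map c ⊗ₜ a) := by
  simp_rw [Z.incl_tmul]
  exact Algebra.TensorProduct.lift_tmul _ _ _ c a

theorem elementGerm_sum_smul_tmul {J : Type*} (s : Finset J) (c : J → k) (b : J → AZ) :
    Z.elementGerm k (∑ j ∈ s, c j • 1 ⊗ₜ b j) =
      germ _ fun p : Point k => Z.incl p.carrier (∑ j ∈ s, p.map (c j) • 1 ⊗ₜ b j) := by
  simp only [TensorProduct.smul_tmul', smul_eq_mul, mul_one, map_sum, elementGerm_tmul]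
  rw [← map_sum]
  congr 1
  ext p
  rw [Finset.sum_apply]

theorem isUnit_elementGerm {w : k ⊗[ℤ] AZ} (hw : w ≠ 0) : IsUnit (Z.elementGerm k w) := by
  obtain ⟨J, b, hspan, hindep⟩ := Z.exists_mem_span_tmul w
  obtain ⟨c, rfl⟩ := Finsupp.mem_span_range_iff_exists_finsupp.1 hspan
  obtain ⟨j, hj⟩ : c.support.Nonempty := by
    rw [Finsupp.support_nonempty_iff]
    rintro rfl
    exact hw Finsupp.sum_zero_index
  rw [Finsupp.sum, Z.elementGerm_sum_smul_tmul]
  refine isUnit_germ ?_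
  filter_upwards [eventually_map_ne_zero (Finsupp.mem_support_iff.1 hj)] with p hp hzero
  rw [map_eq_zero_iff _ (Z.incl_injective _)] at hzero
  exact hp (linearIndependent_iff'.1 (hindep p.carrier) _ _ hzero j hj)

variable [IsAlgClosed k]

variable (k) in
theorem exists_fractionGerm : ∃ θ : Z.Fraction k →+* Z.FractionGerm k,
    ∀ w, θ (Z.incl k w) = Z.elementGerm k w :=
  exists_skewFrac_lift (Z.oreDomain k) (Z.elementGerm k) fun _ => Z.isUnit_elementGerm

variable (k) in
/-- The germ of fractions defined by an element of `Frac A_k`. -/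
def fractionGerm : Z.Fraction k →+* Z.FractionGerm k := (Z.exists_fractionGerm k).choose

theorem fractionGerm_incl (w : k ⊗[ℤ] AZ) :
    Z.fractionGerm k (Z.incl k w) = Z.elementGerm k w :=
  (Z.exists_fractionGerm k).choose_spec w

theorem eventually_spread_algebraMap (a : k) : ∀ᶠ p in diagramFilter k,
    spread (Z.fractionGerm k) (algebraMap k (Z.Fraction k) a) p =
      algebraMap p.carrier _ (p.map a) := by
  rw [eventually_spread_eq_iff, ← AlgHom.commutes (Z.incl k), Z.fractionGerm_incl,
    Algebra.TensorProduct.algebraMap_apply, Z.elementGerm_tmul]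
  simp_rw [Z.incl_tmul, map_one, mul_one]
  rfl

theorem eventually_spread_toFraction (a : AZ) : ∀ᶠ p in diagramFilter k,
    spread (Z.fractionGerm k) (Z.toFraction k a) p = Z.toFraction p.carrier a := by
  rw [eventually_spread_eq_iff, toFraction_apply, fractionGerm_incl, elementGerm_tmul,
    germ_eq_germ_iff]
  filter_upwards [eventually_map_one (k := k)] with p hp
  rw [hp, toFraction_apply]

theorem eventually_spread_mem_adjoin {S : Set (Z.Fraction k)} {x : Z.Fraction k}
    (hx : x ∈ Algebra.adjoin k S) : ∀ᶠ p in diagramFilter k,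
      spread (Z.fractionGerm k) x p ∈
        Algebra.adjoin p.carrier ((fun y => spread (Z.fractionGerm k) y p) '' S) := by
  induction hx using Algebra.adjoin_induction with
  | mem x hx => exact .of_forall fun p => Algebra.subset_adjoin (Set.mem_image_of_mem _ hx)
  | algebraMap c =>
    filter_upwards [Z.eventually_spread_algebraMap c] with p hp
    exact hp ▸ Subalgebra.algebraMap_mem _ _
  | add x y _ _ hx hy =>
    filter_upwards [eventually_spread_add (Z.fractionGerm k) x y, hx, hy] with p hp hx hy
    exact hp ▸ add_mem hx hy
  | mul x y _ _ hx hy =>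
    filter_upwards [eventually_spread_mul (Z.fractionGerm k) x y, hx, hy] with p hp hx hy
    exact hp ▸ mul_mem hx hy

end FractionGerm

end ZCompatible

/-! ### Weyl algebras -/

section WeylFamily

variable {ι B : Type*} [DecidableEq ι] [Ring B]

/-- The families `X` and `Y` satisfy the defining relations of a Weyl algebra. -/
structure IsWeylFamily (X Y : ι → B) : Prop where
  lie_x_x : ∀ i j, ⁅X i, X j⁆ = 0
  lie_y_y : ∀ i j, ⁅Y i, Y j⁆ = 0
  lie_y_x : ∀ i j, ⁅Y i, X j⁆ = if i = j then 1 else 0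

namespace IsWeylFamily

variable {X Y : ι → B} (h : IsWeylFamily X Y)
include h

theorem map {C : Type*} [Ring C] (f : B →+* C) : IsWeylFamily (f ∘ X) (f ∘ Y) where
  lie_x_x i j := by simpa [Ring.lie_def] using congrArg f (h.lie_x_x i j)
  lie_y_y i j := by simpa [Ring.lie_def] using congrArg f (h.lie_y_y i j)
  lie_y_x i j := by simpa [Ring.lie_def, apply_ite f] using congrArg f (h.lie_y_x i j)

theorem isDualFamily (R : Type*) [CommRing R] [Algebra R B] :
    IsDualFamily R (Sum.elim X Y) (Sum.elim Y (-X)) where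
  lie_mem_one := by
    have lie_y_x_mem (i j : ι) : ⁅Y i, X j⁆ ∈ (1 : Submodule R B) := by
      rw [h.lie_y_x]
      split_ifs
      exacts [Submodule.one_le.1 le_rfl, zero_mem _]
    rintro (i | i) (j | j)
    · simp [h.lie_x_x]
    · simpa only [Sum.elim_inl, Sum.elim_inr, lie_skew] using neg_mem (lie_y_x_mem j i)
    · exact lie_y_x_mem i j
    · simp [h.lie_y_y]
  lie_dual := by
    rintro (i | i) (j | j)
    · simp [h.lie_y_x]
    · simp [h.lie_y_y]
    · simp [h.lie_x_x]
    · simp [h.lie_y_x, eq_comm (a := i)]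

theorem exists_left_ore [Finite ι] [IsDomain B] {K : Type*} [Field K] [Algebra K B] {a b : B}
    (ha : a ∈ Algebra.adjoin K (Set.range X ∪ Set.range Y))
    (hb : b ∈ Algebra.adjoin K (Set.range X ∪ Set.range Y)) (hb0 : b ≠ 0) :
    ∃ c ∈ Algebra.adjoin K (Set.range X ∪ Set.range Y),
      ∃ d ∈ Algebra.adjoin K (Set.range X ∪ Set.range Y), d ≠ 0 ∧ d * a = c * b := by
  rw [← Set.Sum.elim_range] at *
  refine exists_left_ore_of_lie_mem_one (Set.finite_range _) ?_ ha hb hb0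
  rintro _ ⟨a, rfl⟩ _ ⟨b, rfl⟩
  exact (h.isDualFamily K).lie_mem_one a b

end IsWeylFamily

end WeylFamily

section WeylAlgebra

variable (K : Type*) [CommRing K] (n : ℕ)

/-- The generator `x_i` of the Weyl algebra. -/
def weylX (i : Fin n) : WeylAlgebra K n :=
  RingQuot.mkAlgHom K (WeylRel K n) (FreeAlgebra.ι K (Sum.inl i))

/-- The generator `y_i` of the Weyl algebra. -/
def weylY (i : Fin n) : WeylAlgebra K n :=
  RingQuot.mkAlgHom K (WeylRel K n) (FreeAlgebra.ι K (Sum.inr i))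

theorem isWeylFamily_weyl : IsWeylFamily (weylX K n) (weylY K n) where
  lie_x_x i j := by
    simpa [Ring.lie_def, weylX] using RingQuot.mkAlgHom_rel K (WeylRel.xx (K := K) i j)
  lie_y_y i j := by
    simpa [Ring.lie_def, weylY] using RingQuot.mkAlgHom_rel K (WeylRel.yy (K := K) i j)
  lie_y_x i j := by
    simpa [Ring.lie_def, weylX, weylY, apply_ite (RingQuot.mkAlgHom K (WeylRel K n))]
      using RingQuot.mkAlgHom_rel K (WeylRel.yx (K := K) i j)

theorem adjoin_weyl :
    Algebra.adjoin K (Set.range (weylX K n) ∪ Set.range (weylY K n)) = ⊤ := by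
  have range_weyl : Set.range (weylX K n) ∪ Set.range (weylY K n) =
      RingQuot.mkAlgHom K (WeylRel K n) '' Set.range (FreeAlgebra.ι K) := by
    rw [← Set.range_comp, ← Set.Sum.elim_range]
    congr 1
    ext (i | i) <;> rfl
  rw [range_weyl, ← AlgHom.map_adjoin, FreeAlgebra.adjoin_range_ι, Algebra.map_top,
    AlgHom.range_eq_top]
  exact RingQuot.mkAlgHom_surjective K (WeylRel K n)

variable {n} {B : Type*} [Ring B] [Algebra K B] {X Y : Fin n → B}

/-- The homomorphism from the Weyl algebra which maps its generators to a given Weyl family. -/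
def IsWeylFamily.lift (h : IsWeylFamily X Y) : WeylAlgebra K n →ₐ[K] B :=
  RingQuot.liftAlgHom K ⟨FreeAlgebra.lift K (Sum.elim X Y), by
    rintro _ _ (⟨i, j⟩ | ⟨i, j⟩ | ⟨i, j⟩)
    · simpa [Ring.lie_def] using h.lie_x_x i j
    · simpa [Ring.lie_def] using h.lie_y_y i j
    · simpa [Ring.lie_def, apply_ite (FreeAlgebra.lift K (Sum.elim X Y))] using h.lie_y_x i j⟩

variable {K}

theorem IsWeylFamily.range_lift (h : IsWeylFamily X Y) :
    (h.lift K).range = Algebra.adjoin K (Set.range X ∪ Set.range Y) := by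
  have lift_comp_x : h.lift K ∘ weylX K n = X := by ext i; simp [lift, weylX]
  have lift_comp_y : h.lift K ∘ weylY K n = Y := by ext i; simp [lift, weylY]
  rw [← Algebra.map_top, ← adjoin_weyl, AlgHom.map_adjoin, Set.image_union, ← Set.range_comp,
    ← Set.range_comp, lift_comp_x, lift_comp_y]

theorem weylAlgebra_algHom_injective {K : Type*} [Field K] [CharZero K] {B : Type*} [Ring B]
    [Algebra K B] [Nontrivial B] (f : WeylAlgebra K n →ₐ[K] B) : Function.Injective f := by
  have injOn := ((isWeylFamily_weyl K n).isDualFamily K).injOn_adjoin f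
  rwa [Set.Sum.elim_range, adjoin_weyl, Algebra.coe_top, Set.injOn_univ] at injOn

end WeylAlgebra

/-! ### Division rings of left fractions -/

section LeftFraction

/-- `x` is a left fraction `p⁻¹ q` of elements of `s`. -/
def IsLeftFraction {D : Type*} [Ring D] (s : Set D) (x : D) : Prop :=
  ∃ p ∈ s, p ≠ 0 ∧ p * x ∈ s

theorem IsLeftFraction.mono {D : Type*} [Ring D] {s t : Set D} {x : D} (hx : IsLeftFraction s x)
    (h : s ⊆ t) : IsLeftFraction t x :=
  let ⟨p, hp, hp0, hpx⟩ := hx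
  ⟨p, h hp, hp0, h hpx⟩

theorem IsLeftFraction.commute {D : Type*} [Ring D] [IsDomain D] {s : Set D} {x z : D}
    (hx : IsLeftFraction s x) (hz : ∀ p ∈ s, Commute z p) : Commute z x := by
  obtain ⟨p, hp, hp0, hpx⟩ := hx
  refine mul_left_cancel₀ hp0 ?_
  rw [← mul_assoc, ← (hz p hp).eq, mul_assoc, (hz _ hpx).eq, mul_assoc]

variable {D : Type*} [DivisionRing D]

/-- The division ring of left fractions of a subring satisfying the left Ore condition. -/
def leftFractions (R : Subring D)
    (ore : ∀ a ∈ R, ∀ b ∈ R, b ≠ 0 → ∃ c ∈ R, ∃ d ∈ R, d ≠ 0 ∧ d * a = c * b) : Subfield D where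
  carrier := {x | IsLeftFraction R x}
  one_mem' := ⟨1, one_mem R, one_ne_zero, by rw [one_mul]; exact one_mem R⟩
  zero_mem' := ⟨1, one_mem R, one_ne_zero, by rw [mul_zero]; exact zero_mem R⟩
  neg_mem' := by
    rintro x ⟨p, hp, hp0, hpx⟩
    exact ⟨p, hp, hp0, by rw [mul_neg]; exact neg_mem hpx⟩
  add_mem' := by
    rintro x y ⟨p, hp, hp0, hpx⟩ ⟨q, hq, hq0, hqy⟩
    obtain ⟨c, hc, d, hd, hd0, e⟩ := ore p hp q hq hq0
    refine ⟨d * p, mul_mem hd hp, mul_ne_zero hd0 hp0, ?_⟩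
    rw [mul_add, mul_assoc, e, mul_assoc]
    exact add_mem (mul_mem hd hpx) (mul_mem hc hqy)
  mul_mem' := by
    rintro x y ⟨p, hp, hp0, hpx⟩ ⟨q, hq, hq0, hqy⟩
    obtain ⟨c, hc, d, hd, hd0, e⟩ := ore (p * x) hpx q hq hq0
    refine ⟨d * p, mul_mem hd hp, mul_ne_zero hd0 hp0, ?_⟩
    rw [← mul_assoc, mul_assoc d, e, mul_assoc]
    exact mul_mem hc hqy
  inv_mem' := by
    rintro x ⟨p, hp, hp0, hpx⟩
    rcases eq_or_ne x 0 with rfl | hx0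
    · exact ⟨p, hp, hp0, by rwa [inv_zero]⟩
    · exact ⟨p * x, hpx, mul_ne_zero hp0 hx0, by rwa [mul_inv_cancel_right₀ hx0]⟩

theorem commute_of_subfieldClosure_eq_top {G : Set D} (hG : Subfield.closure G = ⊤) {z : D}
    (hz : ∀ g ∈ G, Commute z g) (d : D) : Commute z d := by
  have hd : d ∈ Subfield.closure G := hG ▸ Subfield.mem_top d
  induction hd using Subfield.closure_induction with
  | mem g hg => exact hz g hg
  | one => exact Commute.one_right z
  | add a b _ _ ha hb => exact ha.add_right hb
  | neg a _ ha => exact ha.neg_right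
  | inv a _ ha => exact ha.inv_right₀
  | mul a b _ _ ha hb => exact ha.mul_right hb

theorem isUnit_center {k : Type*} [CommRing k] [Algebra k D] {c : Subalgebra.center k D}
    (hc : c ≠ 0) : IsUnit c := by
  have hc0 : (c : D) ≠ 0 := fun h => hc (Subtype.ext h)
  refine IsUnit.of_mul_eq_one ⟨(c : D)⁻¹, Set.inv_mem_center c.2⟩ ?_
  exact Subtype.ext (mul_inv_cancel₀ hc0)

end LeftFraction

namespace IsSkewFieldOfFractions

variable {R D : Type*} [Ring R] [DivisionRing D] {f : R →+* D} (hf : IsSkewFieldOfFractions f)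
include hf

theorem exists_map_mul_eq (d : D) : ∃ a b : R, f b ≠ 0 ∧ f b * d = f a := by
  obtain ⟨a, b, hb, rfl⟩ := hf.exists_fraction d
  have hfb : f b ≠ 0 := (map_ne_zero_iff f hf.injective).2 hb
  exact ⟨a, b, hfb, mul_inv_cancel_left₀ hfb (f a)⟩

theorem isLeftFraction_range (d : D) : IsLeftFraction (Set.range f) d := by
  obtain ⟨a, b, hb, h⟩ := hf.exists_map_mul_eq d
  exact ⟨f b, ⟨b, rfl⟩, hb, a, h.symm⟩

theorem map_mem_center {c : R} (hc : c ∈ Set.center R) : f c ∈ Set.center D := by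
  refine Semigroup.mem_center_iff.2 fun d => ?_
  have commute_range : ∀ p ∈ Set.range f, Commute (f c) p := by
    rintro _ ⟨r, rfl⟩
    exact Commute.map (Semigroup.mem_center_iff.1 hc r).symm f
  exact ((hf.isLeftFraction_range d).commute commute_range).symm

theorem comp_ringEquiv {D' : Type*} [DivisionRing D'] (e : D ≃+* D') :
    IsSkewFieldOfFractions ((e : D →+* D').comp f) where
  injective := e.injective.comp hf.injective
  exists_fraction d := by
    obtain ⟨a, b, hb, h⟩ := hf.exists_fraction (e.symm d)
    exact ⟨a, b, hb, by simpa using congrArg e h⟩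

end IsSkewFieldOfFractions

theorem isSkewFieldOfFractions_of_isLeftFraction {R D : Type*} [Ring R] [DivisionRing D]
    {f : R →+* D} (hf : Function.Injective f) (h : ∀ d, IsLeftFraction (Set.range f) d) :
    IsSkewFieldOfFractions f where
  injective := hf
  exists_fraction d := by
    obtain ⟨_, ⟨b, rfl⟩, hb, a, ha⟩ := h d
    exact ⟨a, b, ne_zero_of_map hb, by rw [ha, inv_mul_cancel_left₀ hb]⟩

/-! ### Algebraic dependence -/

section Algebraic

/-- `x` is a root of a nonzero polynomial, evaluated with the powers of `x` on the right of the
coefficients, all of which belong to `s`. -/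
def IsLeftAlgebraic {D : Type*} [Ring D] (s : Set D) (x : D) : Prop :=
  ∃ (N : ℕ) (c : Fin N → D), c ≠ 0 ∧ (∀ m, c m ∈ s) ∧ ∑ m, c m * x ^ (m : ℕ) = 0

variable {k C D : Type*} [Field k] [CommRing C] [Algebra k C] [Ring D] [Algebra k D]

theorem isAlgebraic_iff_isLeftAlgebraic_map (f : C →ₐ[k] D) (hf : Function.Injective f)
    (S : Subalgebra k C) {x : C} : IsAlgebraic S x ↔ IsLeftAlgebraic (S.map f) (f x) := by
  classical
  constructor
  · rintro ⟨p, hp0, hp⟩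
    refine ⟨p.natDegree + 1, fun m => f (p.coeff m), fun h => ?_, fun m => ⟨_, (p.coeff m).2, rfl⟩,
      ?_⟩
    · have leadingCoeff_eq : f (p.coeff p.natDegree) = 0 :=
        congrFun h (Fin.last p.natDegree)
      rw [map_eq_zero_iff f hf, ZeroMemClass.coe_eq_zero] at leadingCoeff_eq
      exact hp0 (Polynomial.leadingCoeff_eq_zero.1 leadingCoeff_eq)
    · rw [Polynomial.aeval_eq_sum_range] at hp
      rw [Fin.sum_univ_eq_sum_range (fun m => f (p.coeff m) * f x ^ m), ← map_zero f, ← hp, map_sum]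
      refine Finset.sum_congr rfl fun m _ => ?_
      rw [Subalgebra.smul_def, smul_eq_mul, map_mul, map_pow]
  · rintro ⟨N, c, hc0, hc, h⟩
    choose q hqS hq using hc
    let q' : Fin N → S := fun m => ⟨q m, hqS m⟩
    refine ⟨Polynomial.ofFn N q', fun h0 => hc0 ?_, hf ?_⟩
    · have q'_eq : q' = 0 := Polynomial.injective_ofFn N (h0.trans (Polynomial.ofFn_zero N).symm)
      funext m
      rw [← hq, show q m = 0 from congrArg Subtype.val (congrFun q'_eq m), map_zero, Pi.zero_apply]
    · rw [Polynomial.ofFn_eq_sum_monomial, map_sum, map_sum, map_zero, ← h]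
      refine Finset.sum_congr rfl fun m _ => ?_
      rw [Polynomial.aeval_monomial, map_mul, map_pow, ← hq]
      rfl

theorem indep_of_subset_closure {α : Type*} {M : Matroid α} {I J : Set α} (hI : M.Indep I)
    (hIJ : I ⊆ M.closure J) (hJ : J.Finite) (hcard : J.encard ≤ I.encard) : M.Indep J := by
  rw [Matroid.indep_iff_eRk_eq_encard_of_finite hJ]
  refine (M.eRk_le_encard J).antisymm (hcard.trans ?_)
  rw [← hI.eRk_eq_encard, ← M.eRk_closure_eq J]
  exact M.eRk_mono hIJ

theorem algebraicIndependent_of_isAlgebraic [IsDomain C] {ι : Type*} [Finite ι] {x t : ι → C}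
    (hx : AlgebraicIndependent k x)
    (h : ∀ i, IsAlgebraic (Algebra.adjoin k (Set.range t)) (x i)) : AlgebraicIndependent k t := by
  let M := AlgebraicIndependent.matroid k C
  have hxM : M.Indep (Set.range x) := hx.to_subtype_range
  have range_x_subset : Set.range x ⊆ M.closure (Set.range t) := by
    rw [AlgebraicIndependent.matroid_closure_eq]
    rintro _ ⟨i, rfl⟩
    exact h i
  have le_encard_x : ENat.card ι ≤ (Set.range x).encard := hx.injective.encard_range
  have encard_t_le : (Set.range t).encard ≤ ENat.card ι := by
    rw [← Set.image_univ, ← Set.encard_univ]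
    exact Set.encard_image_le _ _
  have ht : M.Indep (Set.range t) :=
    indep_of_subset_closure hxM range_x_subset (Set.finite_range t)
      (encard_t_le.trans le_encard_x)
  have le_encard_t : ENat.card ι ≤ (Set.range t).encard := by
    refine le_encard_x.trans ?_
    rw [← hxM.eRk_eq_encard, ← ht.eRk_eq_encard, ← M.eRk_closure_eq (Set.range t)]
    exact M.eRk_mono range_x_subset
  have t_injective : Function.Injective t := by
    rw [← Set.injOn_univ]
    refine Set.finite_univ.injOn_of_encard_image_eq ?_
    rw [Set.image_univ, Set.encard_univ, encard_t_le.antisymm le_encard_t]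
  exact (algebraicIndependent_subtype_range t_injective).1 ht

theorem trdeg_fractionRing_of_algEquiv [IsDomain C] {s : ℕ}
    (e : MvPolynomial (Fin s) k ≃ₐ[k] C) : Algebra.trdeg k (FractionRing C) = s := by
  have : Algebra.IsAlgebraic C (FractionRing C) := IsLocalization.isAlgebraic _ (nonZeroDivisors C)
  have basis := e.isTranscendenceBasis (IsTranscendenceBasis.mvPolynomial (Fin s) k)
  simpa using (basis.algebraMap_comp (A := FractionRing C)).lift_cardinalMk_eq_trdeg.symm

end Algebraic

/-! ### Weyl generators of a division algebra -/

section WeylGenerating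

variable {k D : Type*} [Field k] [DivisionRing D] [Algebra k D]

variable (k) in
/-- The families `X`, `Y` and `T` satisfy the relations of `A_n(k[t_1, …, t_l])`, the elements of
`G` are left fractions of polynomials in them, and the `z_i` are algebraic over the `T_j`. For
generators `G` of `D` and algebraically independent central `z_1, …, z_l`, such families present `D`
as the Weyl field `𝔻_{n,l}(k)` by finitely many equations and inequations. -/
structure IsWeylGenerating (G : Set D) {s n l : ℕ} (z : Fin s → D) (X Y : Fin n → D)
    (T : Fin l → D) : Prop where
  isWeylFamily : IsWeylFamily X Y
  lie_t_x : ∀ i j, ⁅T i, X j⁆ = 0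
  lie_t_y : ∀ i j, ⁅T i, Y j⁆ = 0
  lie_t_t : ∀ i j, ⁅T i, T j⁆ = 0
  isLeftFraction : ∀ v ∈ G,
    IsLeftFraction (Algebra.adjoin k (Set.range X ∪ Set.range Y ∪ Set.range T) : Set D) v
  isLeftAlgebraic : ∀ i, IsLeftAlgebraic (Algebra.adjoin k (Set.range T) : Set D) (z i)

/-- The central generator `t_j` of `A_{n,l}(k)`. -/
def weylT (k : Type*) [Field k] (n l : ℕ) (j : Fin l) : WeylAlgebraOver k n l :=
  algebraMap (MvPolynomial (Fin l) k) (WeylAlgebraOver k n l) (MvPolynomial.X j)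

theorem algebraMap_mvPolynomial_mem_adjoin {σ B : Type*} [Ring B] [Algebra k B]
    [Algebra (MvPolynomial σ k) B] [IsScalarTower k (MvPolynomial σ k) B] (p : MvPolynomial σ k) :
    algebraMap (MvPolynomial σ k) B p ∈ Algebra.adjoin k
      (Set.range fun j => algebraMap (MvPolynomial σ k) B (MvPolynomial.X j)) := by
  induction p using MvPolynomial.induction_on with
  | C c =>
    rw [← MvPolynomial.algebraMap_eq, ← IsScalarTower.algebraMap_apply]
    exact Subalgebra.algebraMap_mem _ c
  | add p q hp hq => rw [map_add]; exact add_mem hp hq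
  | mul_X p j hp => rw [map_mul]; exact mul_mem hp (Algebra.subset_adjoin ⟨j, rfl⟩)

theorem adjoin_mvPolynomial_le {σ B : Type*} [Ring B] [Algebra k B] [Algebra (MvPolynomial σ k) B]
    [IsScalarTower k (MvPolynomial σ k) B] (s : Set B) :
    (Algebra.adjoin (MvPolynomial σ k) s).restrictScalars k ≤ Algebra.adjoin k
      (s ∪ Set.range fun j => algebraMap (MvPolynomial σ k) B (MvPolynomial.X j)) := by
  intro x hx
  rw [Subalgebra.mem_restrictScalars] at hx
  induction hx using Algebra.adjoin_induction with
  | mem x hx => exact Algebra.subset_adjoin (Or.inl hx)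
  | algebraMap p =>
    exact Algebra.adjoin_mono Set.subset_union_right (algebraMap_mvPolynomial_mem_adjoin p)
  | add x y _ _ hx hy => exact add_mem hx hy
  | mul x y _ _ hx hy => exact mul_mem hx hy

theorem exists_smul_mem_adjoin {R K B : Type*} [CommRing R] [CommRing K] [Algebra R K]
    (M : Submonoid R) [IsLocalization M K] [Ring B] [Algebra R B] [Algebra K B]
    [IsScalarTower R K B] {s : Set B} {x : B} (hx : x ∈ Algebra.adjoin K s) :
    ∃ r ∈ M, r • x ∈ Algebra.adjoin R s := by
  rw [← Subalgebra.mem_toSubmodule, Algebra.adjoin_eq_span] at hx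
  obtain ⟨r, hr⟩ := multiple_mem_span_of_mem_localization_span M K _ x hx
  refine ⟨r, r.2, ?_⟩
  rwa [← Subalgebra.mem_toSubmodule, Algebra.adjoin_eq_span]

theorem weylAlgebraOver_exists_smul_mem_adjoin {n l : ℕ} (a : WeylAlgebraOver k n l) :
    ∃ p ∈ nonZeroDivisors (MvPolynomial (Fin l) k), p • a ∈ Algebra.adjoin (MvPolynomial (Fin l) k)
      (Set.range (weylX (RatFunField k l) n) ∪ Set.range (weylY (RatFunField k l) n)) := by
  refine exists_smul_mem_adjoin (K := RatFunField k l) _ ?_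
  rw [adjoin_weyl]
  exact Algebra.mem_top

theorem comp_toAlgHom_mvPolynomial_injective {n l : ℕ} (g : WeylAlgebraOver k n l →ₐ[k] D) :
    Function.Injective
      (g.comp (IsScalarTower.toAlgHom k (MvPolynomial (Fin l) k) (WeylAlgebraOver k n l))) :=
  (g.toRingHom.comp (algebraMap (RatFunField k l) (WeylAlgebraOver k n l))).injective.comp
    (IsFractionRing.injective (MvPolynomial (Fin l) k) (RatFunField k l))

theorem isAlgebraic_adjoin_of_trdeg_eq {C : Type*} [CommRing C] [IsDomain C] [Algebra k C] {l : ℕ}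
    (htr : Algebra.trdeg k C = l) {t : Fin l → C} (ht : AlgebraicIndependent k t) (c : C) :
    IsAlgebraic (Algebra.adjoin k (Set.range t)) c := by
  have basis : IsTranscendenceBasis k t :=
    ht.isTranscendenceBasis_of_lift_trdeg_le_of_finite (by simp [htr])
  exact basis.isAlgebraic.isAlgebraic c

section Extraction

variable {n l : ℕ} {g : WeylAlgebraOver k n l →ₐ[k] D}
  (hg : IsSkewFieldOfFractions (g : WeylAlgebraOver k n l →+* D))
include hg

-- A common multiple of the denominators from `k[t_1, …, t_l]` turns a fraction of elements of
-- `A_{n,l}(k)` into one of polynomials in the generators.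
theorem isLeftFraction_adjoin_weyl (d : D) :
    IsLeftFraction (Algebra.adjoin k (Set.range (g ∘ weylX (RatFunField k l) n) ∪
      Set.range (g ∘ weylY (RatFunField k l) n) ∪ Set.range (g ∘ weylT k n l)) : Set D) d := by
  obtain ⟨a, b, hb, hab⟩ := hg.exists_map_mul_eq d
  obtain ⟨p, hp, hpa⟩ := weylAlgebraOver_exists_smul_mem_adjoin a
  obtain ⟨q, hq, hqb⟩ := weylAlgebraOver_exists_smul_mem_adjoin b
  have map_mem {c : WeylAlgebraOver k n l} (hc : c ∈ Algebra.adjoin (MvPolynomial (Fin l) k)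
      (Set.range (weylX (RatFunField k l) n) ∪ Set.range (weylY (RatFunField k l) n))) :
      g c ∈ Algebra.adjoin k (Set.range (g ∘ weylX (RatFunField k l) n) ∪
        Set.range (g ∘ weylY (RatFunField k l) n) ∪ Set.range (g ∘ weylT k n l)) := by
    simp only [Set.range_comp, ← Set.image_union, ← AlgHom.map_adjoin]
    exact ⟨c, adjoin_mvPolynomial_le _ hc, rfl⟩
  have map_smul_eq (r : MvPolynomial (Fin l) k) (c : WeylAlgebraOver k n l) :
      g (r • c) = g (algebraMap _ _ r) * g c := by rw [Algebra.smul_def, map_mul]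
  refine ⟨g ((p * q) • b), map_mem ?_, ?_, ?_⟩
  · rw [mul_smul]
    exact Subalgebra.smul_mem _ hqb p
  · rw [map_smul_eq]
    exact mul_ne_zero ((map_ne_zero_iff _ (comp_toAlgHom_mvPolynomial_injective g)).2
      (nonZeroDivisors.ne_zero (mul_mem hp hq))) hb
  · rw [map_smul_eq, mul_assoc, show g b * d = g a from hab, ← map_smul_eq, mul_comm, mul_smul]
    exact map_mem (Subalgebra.smul_mem _ hpa q)

theorem isWeylGenerating_of_isSkewFieldOfFractions
    (htr : Algebra.trdeg k (Subalgebra.center k D) = l) (G : Set D) {s : ℕ} {z : Fin s → D}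
    (hz : ∀ i, z i ∈ Subalgebra.center k D) :
    IsWeylGenerating k G z (g ∘ weylX (RatFunField k l) n) (g ∘ weylY (RatFunField k l) n)
      (g ∘ weylT k n l) := by
  have t_central (p : MvPolynomial (Fin l) k) :
      g (algebraMap _ _ p) ∈ Subalgebra.center k D :=
    hg.map_mem_center (Set.algebraMap_mem_center p)
  let φ : MvPolynomial (Fin l) k →ₐ[k] Subalgebra.center k D :=
    (g.comp (IsScalarTower.toAlgHom k _ (WeylAlgebraOver k n l))).codRestrict _ t_central
  have independent : AlgebraicIndependent k (φ ∘ MvPolynomial.X) :=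
    (MvPolynomial.algebraicIndependent_X (Fin l) k).map'
      ((AlgHom.injective_codRestrict ..).2 (comp_toAlgHom_mvPolynomial_injective g))
  have adjoin_eq : (Algebra.adjoin k (Set.range (φ ∘ MvPolynomial.X))).map
      (Subalgebra.center k D).val = Algebra.adjoin k (Set.range (g ∘ weylT k n l)) := by
    rw [AlgHom.map_adjoin, ← Set.range_comp]
    rfl
  have lie_t (j : Fin l) (d : D) : ⁅(g ∘ weylT k n l) j, d⁆ = 0 :=
    commute_iff_lie_eq.1 (Subalgebra.mem_center_iff.1 (t_central _) d).symm
  exact {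
    isWeylFamily := (isWeylFamily_weyl _ n).map (g : WeylAlgebraOver k n l →+* D)
    lie_t_x := fun i j => lie_t i _
    lie_t_y := fun i j => lie_t i _
    lie_t_t := fun i j => lie_t i _
    isLeftFraction := fun v _ => isLeftFraction_adjoin_weyl hg v
    isLeftAlgebraic := fun i => by
      rw [← adjoin_eq]
      exact (isAlgebraic_iff_isLeftAlgebraic_map _ Subtype.val_injective _).1
        (isAlgebraic_adjoin_of_trdeg_eq htr independent ⟨z i, hz i⟩) }

end Extraction

section Reconstruction

theorem IsWeylFamily.isSkewFieldOfFractions_lift {K : Type*} [Field K] [CharZero K] [Algebra K D]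
    {n : ℕ} {X Y : Fin n → D} (h : IsWeylFamily X Y) {G : Set D} (hG : Subfield.closure G = ⊤)
    (hfrac : ∀ v ∈ G, IsLeftFraction (Algebra.adjoin K (Set.range X ∪ Set.range Y) : Set D) v) :
    IsSkewFieldOfFractions (h.lift K : WeylAlgebra K n →+* D) := by
  refine isSkewFieldOfFractions_of_isLeftFraction (weylAlgebra_algHom_injective _) fun d => ?_
  let Q : Subfield D := leftFractions (Algebra.adjoin K (Set.range X ∪ Set.range Y)).toSubring
    fun a ha b hb => h.exists_left_ore ha hb
  have le_Q : Subfield.closure G ≤ Q := Subfield.closure_le.2 hfrac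
  have hd : d ∈ Q := le_Q (hG ▸ Subfield.mem_top d)
  refine IsLeftFraction.mono hd fun p hp => ?_
  have hp' : p ∈ (h.lift K).range := by rwa [h.range_lift]
  exact hp'

theorem adjoin_union_le_restrictScalars {k K B : Type*} [CommRing k] [CommRing K] [Ring B]
    [Algebra k K] [Algebra K B] [Algebra k B] [IsScalarTower k K B] {s t : Set B}
    (ht : t ⊆ Set.range (algebraMap K B)) :
    Algebra.adjoin k (s ∪ t) ≤ (Algebra.adjoin K s).restrictScalars k := by
  refine Algebra.adjoin_le (Set.union_subset Algebra.subset_adjoin fun x hx => ?_)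
  obtain ⟨c, rfl⟩ := ht hx
  exact Subalgebra.algebraMap_mem (Algebra.adjoin K s) c

namespace IsWeylGenerating

variable {G : Set D} {s n l : ℕ} {z : Fin s → D} {X Y : Fin n → D} {T : Fin l → D}

theorem t_mem_center (h : IsWeylGenerating k G z X Y T)
    (hG : Subfield.closure (Set.range (algebraMap k D) ∪ G) = ⊤) (j : Fin l) :
    T j ∈ Subalgebra.center k D := by
  have adjoin_le : Algebra.adjoin k (Set.range X ∪ Set.range Y ∪ Set.range T) ≤
      Subalgebra.centralizer k {T j} := by
    refine Algebra.adjoin_le ?_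
    rintro _ ((⟨i, rfl⟩ | ⟨i, rfl⟩) | ⟨i, rfl⟩) <;>
      refine (Subalgebra.mem_centralizer_iff k).2 ?_ <;> rintro _ rfl
    exacts [commute_iff_lie_eq.2 (h.lie_t_x j i), commute_iff_lie_eq.2 (h.lie_t_y j i),
      commute_iff_lie_eq.2 (h.lie_t_t j i)]
  refine Subalgebra.mem_center_iff.2 fun d =>
    (commute_of_subfieldClosure_eq_top hG (z := T j) ?_ d).symm
  rintro v (⟨c, rfl⟩ | hv)
  · exact (Algebra.commutes c _).symm
  · exact (h.isLeftFraction v hv).commute fun p hp =>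
      (Subalgebra.mem_centralizer_iff k).1 (adjoin_le hp) _ rfl

theorem algebraicIndependent {z : Fin l → D} (h : IsWeylGenerating k G z X Y T)
    {z' t : Fin l → Subalgebra.center k D} (hz' : AlgebraicIndependent k z')
    (hz : ∀ i, (z' i : D) = z i) (ht : ∀ j, (t j : D) = T j) : AlgebraicIndependent k t := by
  refine algebraicIndependent_of_isAlgebraic hz' fun i =>
    (isAlgebraic_iff_isLeftAlgebraic_map (Subalgebra.center k D).val Subtype.val_injective _).2 ?_
  have t_comp : (Subalgebra.center k D).val ∘ t = T := funext ht
  rw [AlgHom.map_adjoin, ← Set.range_comp, t_comp, Subalgebra.coe_val, hz i]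
  exact h.isLeftAlgebraic i

theorem isSkewFieldOfFractions_lift {K : Type*} [Field K] [CharZero K] [Algebra k K] [Algebra K D]
    [IsScalarTower k K D] (h : IsWeylGenerating k G z X Y T)
    (hG : Subfield.closure (Set.range (algebraMap k D) ∪ G) = ⊤)
    (hT : Set.range T ⊆ Set.range (algebraMap K D)) :
    IsSkewFieldOfFractions (h.isWeylFamily.lift K : WeylAlgebra K n →+* D) := by
  refine h.isWeylFamily.isSkewFieldOfFractions_lift hG ?_
  rintro _ (⟨c, rfl⟩ | hv)
  · rw [IsScalarTower.algebraMap_apply k K D]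
    refine ⟨1, one_mem _, one_ne_zero, ?_⟩
    rw [one_mul]
    exact Subalgebra.algebraMap_mem _ _
  · exact (h.isLeftFraction _ hv).mono (adjoin_union_le_restrictScalars hT)

theorem exists_isSkewFieldOfFractions [CharZero k] {z : Fin l → D}
    (h : IsWeylGenerating k G z X Y T)
    (hG : Subfield.closure (Set.range (algebraMap k D) ∪ G) = ⊤)
    {z' : Fin l → Subalgebra.center k D} (hz' : AlgebraicIndependent k z')
    (hz : ∀ i, (z' i : D) = z i) :
    ∃ f : WeylAlgebraOver k n l →ₐ[k] D,
      IsSkewFieldOfFractions (f : WeylAlgebraOver k n l →+* D) := by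
  let t : Fin l → Subalgebra.center k D := fun j => ⟨T j, h.t_mem_center hG j⟩
  have ht : AlgebraicIndependent k t := h.algebraicIndependent hz' hz fun _ => rfl
  have isUnit_aeval (p : nonZeroDivisors (MvPolynomial (Fin l) k)) :
      IsUnit (MvPolynomial.aeval t (p : MvPolynomial (Fin l) k)) :=
    isUnit_center ((map_ne_zero_iff _ ht).2 (nonZeroDivisors.coe_ne_zero p))
  let φ : RatFunField k l →ₐ[k] Subalgebra.center k D := IsLocalization.liftAlgHom isUnit_aeval
  let : Algebra (RatFunField k l) D :=
    RingHom.toAlgebra' ((Subalgebra.center k D).val.comp φ).toRingHom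
      fun c d => (Subalgebra.mem_center_iff.1 (φ c).2 d).symm
  have : IsScalarTower k (RatFunField k l) D :=
    IsScalarTower.of_algebraMap_eq fun c => (congrArg Subtype.val (φ.commutes c)).symm
  have : CharZero (RatFunField k l) :=
    charZero_of_injective_algebraMap (algebraMap k (RatFunField k l)).injective
  refine ⟨(h.isWeylFamily.lift (RatFunField k l)).restrictScalars k,
    h.isSkewFieldOfFractions_lift hG ?_⟩
  rintro _ ⟨j, rfl⟩
  refine ⟨algebraMap (MvPolynomial (Fin l) k) _ (MvPolynomial.X j), ?_⟩
  have φ_X : φ (algebraMap (MvPolynomial (Fin l) k) _ (MvPolynomial.X j)) = t j :=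
    (IsLocalization.lift_eq isUnit_aeval _).trans (MvPolynomial.aeval_X t j)
  exact congrArg Subtype.val φ_X

end IsWeylGenerating

theorem isoWeylField_of_isSkewFieldOfFractions {k : Type u} {D : Type*} [Field k] [DivisionRing D]
    [Algebra k D] [Small.{u} D] {n l : ℕ} {f : WeylAlgebraOver k n l →ₐ[k] D}
    (hf : IsSkewFieldOfFractions (f : WeylAlgebraOver k n l →+* D)) {B : Type*} [Ring B]
    [Algebra k B] (e : B ≃ₐ[k] D) : IsoWeylField k n l B :=
  let σ : D ≃ₐ[k] Shrink.{u} D := (Shrink.algEquiv k D).symm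
  ⟨Shrink.{u} D, inferInstance, inferInstance, (σ : D →ₐ[k] Shrink.{u} D).comp f,
    hf.comp_ringEquiv σ.toRingEquiv, ⟨e.trans σ⟩⟩

end Reconstruction

end WeylGenerating

/-! ### Weyl generators of the skew fields of a `ℤ`-compatible family -/

section SpreadRelations

variable {I D : Type*} {l : Filter I} {F : I → Type*} [∀ i, Ring (F i)] [Ring D]
  (θ : D →+* GermRing l F)

theorem eventually_spread_lie (x y : D) :
    ∀ᶠ i in l, spread θ ⁅x, y⁆ i = ⁅spread θ x i, spread θ y i⁆ := by
  filter_upwards [eventually_spread_sub θ (x * y) (y * x), eventually_spread_mul θ x y,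
    eventually_spread_mul θ y x] with i hsub hxy hyx
  rw [Ring.lie_def, Ring.lie_def, hsub, hxy, hyx]

theorem eventually_lie_spread_eq_zero {J J' : Type*} [Finite J] [Finite J'] {x : J → D}
    {y : J' → D} (h : ∀ a b, ⁅x a, y b⁆ = 0) :
    ∀ᶠ i in l, ∀ a b, ⁅spread θ (x a) i, spread θ (y b) i⁆ = 0 := by
  simp only [Filter.eventually_all]
  intro a b
  filter_upwards [eventually_spread_lie θ (x a) (y b), eventually_spread_zero θ] with i hlie hzero
  rw [← hlie, h, hzero]

theorem IsWeylFamily.eventually_spread {J : Type*} [DecidableEq J] [Finite J] {X Y : J → D}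
    (h : IsWeylFamily X Y) :
    ∀ᶠ i in l, IsWeylFamily (fun a => spread θ (X a) i) (fun a => spread θ (Y a) i) := by
  have lie_y_x : ∀ᶠ i in l, ∀ a b,
      ⁅spread θ (Y a) i, spread θ (X b) i⁆ = if a = b then 1 else 0 := by
    simp only [Filter.eventually_all]
    intro a b
    filter_upwards [eventually_spread_lie θ (Y a) (X b), eventually_spread_zero θ,
      eventually_spread_one θ] with i hlie hzero hone
    rw [← hlie, h.lie_y_x, apply_ite (fun d => spread θ d i), hzero, hone]
  filter_upwards [eventually_lie_spread_eq_zero θ h.lie_x_x,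
    eventually_lie_spread_eq_zero θ h.lie_y_y, lie_y_x] with i hxx hyy hyx
  exact ⟨hxx, hyy, hyx⟩

end SpreadRelations

theorem adjoin_le_subfieldClosure {k D : Type*} [CommRing k] [DivisionRing D] [Algebra k D]
    (s : Set D) : (Algebra.adjoin k s).toSubring ≤
      (Subfield.closure (Set.range (algebraMap k D) ∪ s)).toSubring := by
  rw [Algebra.adjoin_eq_ring_closure]
  exact Subfield.subring_closure_le _

theorem small_of_finiteType (k : Type u) [CommRing k] (A : Type*) [Ring A] [Algebra k A]
    [Algebra.FiniteType k A] : Small.{u} A := by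
  obtain ⟨s, f, hf⟩ := (Algebra.FiniteType.iff_quotient_freeAlgebra (R := k) (A := A)).1 ‹_›
  let g : FreeAlgebra k (Fin s.card) →ₐ[k] A :=
    FreeAlgebra.lift k fun i => f (FreeAlgebra.ι k (s.equivFin.symm i))
  refine small_of_surjective (f := g) fun a => ?_
  obtain ⟨b, rfl⟩ := hf a
  refine ⟨FreeAlgebra.lift k (fun j => FreeAlgebra.ι k (s.equivFin j)) b, ?_⟩
  rw [← AlgHom.comp_apply]
  congr 1
  ext j
  simp [g]

namespace ZCompatible

variable {AZ : Type v} [Ring AZ] (Z : ZCompatible.{u, v} AZ) {k : Type u} [Field k] [IsAlgClosed k]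

/-- A finite set of generators of the module `gens`. -/
def genSet : Finset AZ := Z.gens_fg.choose

theorem span_genSet : Submodule.span ℤ (Z.genSet : Set AZ) = Z.gens := Z.gens_fg.choose_spec

theorem adjoin_genSet : Algebra.adjoin ℤ (Z.genSet : Set AZ) = ⊤ := by
  refine eq_top_iff.2 fun a _ => ?_
  obtain ⟨i, hi⟩ := Z.exists_mem_filtr a
  rw [← Z.span_genSet] at hi
  exact layer_le_adjoin hi

variable (k) in
omit [IsAlgClosed k] in
theorem adjoin_tmul_genSet :
    Algebra.adjoin k ((fun v => (1 : k) ⊗ₜ[ℤ] v) '' (Z.genSet : Set AZ)) = ⊤ :=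
  Algebra.TensorProduct.adjoin_one_tmul_image_eq_top _ Z.adjoin_genSet

theorem incl_mem_adjoin (w : k ⊗[ℤ] AZ) :
    Z.incl k w ∈ Algebra.adjoin k (Z.toFraction k '' Z.genSet) := by
  have map_adjoin := AlgHom.map_adjoin (Z.incl k)
    ((fun v => (1 : k) ⊗ₜ[ℤ] v) '' (Z.genSet : Set AZ))
  rw [Z.adjoin_tmul_genSet, ← Set.image_comp] at map_adjoin
  exact map_adjoin.le ⟨w, trivial, rfl⟩

variable (k) in
theorem isSkewFieldOfFractions_incl :
    IsSkewFieldOfFractions (Z.incl k : k ⊗[ℤ] AZ →+* Z.Fraction k) := by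
  refine isSkewFieldOfFractions_of_isLeftFraction (Z.incl_injective k) fun d => ?_
  obtain ⟨a, b, hb, hab⟩ := Z.exists_incl_mul_eq d
  exact ⟨Z.incl k b, ⟨b, rfl⟩, (map_ne_zero_iff _ (Z.incl_injective k)).2 hb, a, hab.symm⟩

variable (k) in
theorem subfieldClosure_eq_top :
    Subfield.closure
      (Set.range (algebraMap k (Z.Fraction k)) ∪ Z.toFraction k '' Z.genSet) = ⊤ := by
  refine eq_top_iff.2 fun d _ => ?_
  obtain ⟨a, b, -, rfl⟩ := (Z.isSkewFieldOfFractions_incl k).exists_fraction d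
  exact mul_mem (inv_mem (adjoin_le_subfieldClosure _ (Z.incl_mem_adjoin b)))
    (adjoin_le_subfieldClosure _ (Z.incl_mem_adjoin a))

variable (k) in
theorem small_fraction : Small.{u} (Z.Fraction k) := by
  classical
  have : Algebra.FiniteType k (k ⊗[ℤ] AZ) :=
    ⟨Z.genSet.image fun v => 1 ⊗ₜ v, by rw [Finset.coe_image, Z.adjoin_tmul_genSet]⟩
  have : Small.{u} (k ⊗[ℤ] AZ) := small_of_finiteType k _
  refine small_of_surjective (f := fun p : (k ⊗[ℤ] AZ) × (k ⊗[ℤ] AZ) =>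
    (Z.incl k p.2)⁻¹ * Z.incl k p.1) fun d => ?_
  obtain ⟨a, b, -, hd⟩ := (Z.isSkewFieldOfFractions_incl k).exists_fraction d
  exact ⟨(a, b), hd.symm⟩

section Center

variable (k) [CharZero k]

theorem exists_algebraicIndependent_center :
    ∃ z : Fin Z.s → Subalgebra.center k (Z.Fraction k), AlgebraicIndependent k z ∧
      ∀ i, (z i : Z.Fraction k) = Z.toFraction k (Z.x i) := by
  obtain ⟨e, he⟩ := Z.center_poly k
  let φ : Subalgebra.center k (k ⊗[ℤ] AZ) →ₐ[k] Subalgebra.center k (Z.Fraction k) :=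
    ((Z.incl k).comp (Subalgebra.val _)).codRestrict _ fun c =>
      (Z.isSkewFieldOfFractions_incl k).map_mem_center c.2
  have φ_injective : Function.Injective φ :=
    (AlgHom.injective_codRestrict ..).2 ((Z.incl_injective k).comp Subtype.val_injective)
  have φ_comp_injective : Function.Injective (φ.comp e.toAlgHom) :=
    φ_injective.comp e.injective
  exact ⟨φ.comp e.toAlgHom ∘ MvPolynomial.X,
    (MvPolynomial.algebraicIndependent_X _ k).map' φ_comp_injective,
    fun i => congrArg (Z.incl k) (he i)⟩

theorem trdeg_fractionRing_center :
    Algebra.trdeg k (FractionRing (Subalgebra.center k (k ⊗[ℤ] AZ))) = Z.s := by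
  obtain ⟨e, -⟩ := Z.center_poly k
  have := (Z.oreDomain k).isDomain
  exact trdeg_fractionRing_of_algEquiv e

theorem trdeg_center : Algebra.trdeg k (Subalgebra.center k (Z.Fraction k)) = Z.s := by
  obtain ⟨e⟩ : Nonempty (Subalgebra.center k (Z.Fraction k) ≃ₐ[k]
    FractionRing (Subalgebra.center k (k ⊗[ℤ] AZ))) := Z.center_frac k
  exact e.trdeg_eq.trans (Z.trdeg_fractionRing_center k)

end Center

section Spread

theorem eventually_isLeftFraction_spread {S : Set (Z.Fraction k)} {v : AZ}
    (h : IsLeftFraction (Algebra.adjoin k S : Set (Z.Fraction k)) (Z.toFraction k v)) :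
    ∀ᶠ p in diagramFilter k, IsLeftFraction (Algebra.adjoin p.carrier
      ((fun y => spread (Z.fractionGerm k) y p) '' S) : Set (Z.Fraction p.carrier))
        (Z.toFraction p.carrier v) := by
  obtain ⟨q, hq, hq0, hqv⟩ := h
  filter_upwards [Z.eventually_spread_mem_adjoin hq, Z.eventually_spread_mem_adjoin hqv,
    eventually_spread_ne_zero (Z.fractionGerm k) hq0,
    eventually_spread_mul (Z.fractionGerm k) q (Z.toFraction k v),
    Z.eventually_spread_toFraction v] with p hq hqv hq0 hmul hv
  rw [hmul, hv] at hqv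
  exact ⟨_, hq, hq0, hqv⟩

theorem eventually_isLeftAlgebraic_spread {S : Set (Z.Fraction k)} {a : AZ}
    (h : IsLeftAlgebraic (Algebra.adjoin k S : Set (Z.Fraction k)) (Z.toFraction k a)) :
    ∀ᶠ p in diagramFilter k, IsLeftAlgebraic (Algebra.adjoin p.carrier
      ((fun y => spread (Z.fractionGerm k) y p) '' S) : Set (Z.Fraction p.carrier))
        (Z.toFraction p.carrier a) := by
  obtain ⟨N, c, hc0, hc, hsum⟩ := h
  obtain ⟨m, hm⟩ := Function.ne_iff.1 hc0
  have coeff_mem := Filter.eventually_all.2 fun m => Z.eventually_spread_mem_adjoin (hc m)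
  filter_upwards [coeff_mem, eventually_spread_ne_zero (Z.fractionGerm k) hm,
    eventually_spread_sum_mul_pow (Z.fractionGerm k) (Z.toFraction k a) c,
    eventually_spread_zero (Z.fractionGerm k), Z.eventually_spread_toFraction a]
    with p hmem hm hpow hzero ha
  rw [hsum, hzero, ha] at hpow
  exact ⟨N, _, Function.ne_iff.2 ⟨m, hm⟩, hmem, hpow.symm⟩

theorem eventually_isWeylGenerating_spread {n l : ℕ} {X Y : Fin n → Z.Fraction k}
    {T : Fin l → Z.Fraction k}
    (h : IsWeylGenerating k (Z.toFraction k '' Z.genSet) (Z.toFraction k ∘ Z.x) X Y T) :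
    ∀ᶠ p in diagramFilter k, IsWeylGenerating p.carrier (Z.toFraction p.carrier '' Z.genSet)
      (Z.toFraction p.carrier ∘ Z.x) (fun i => spread (Z.fractionGerm k) (X i) p)
      (fun i => spread (Z.fractionGerm k) (Y i) p)
      (fun i => spread (Z.fractionGerm k) (T i) p) := by
  have isLeftFraction := (Filter.eventually_all_finset Z.genSet).2 fun v hv =>
    Z.eventually_isLeftFraction_spread (h.isLeftFraction _ ⟨v, hv, rfl⟩)
  have isLeftAlgebraic := Filter.eventually_all.2 fun i =>
    Z.eventually_isLeftAlgebraic_spread (h.isLeftAlgebraic i)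
  filter_upwards [h.isWeylFamily.eventually_spread (Z.fractionGerm k),
    eventually_lie_spread_eq_zero (Z.fractionGerm k) h.lie_t_x,
    eventually_lie_spread_eq_zero (Z.fractionGerm k) h.lie_t_y,
    eventually_lie_spread_eq_zero (Z.fractionGerm k) h.lie_t_t, isLeftFraction, isLeftAlgebraic]
    with p hweyl htx hty htt hfrac halg
  simp only [Set.image_union, ← Set.range_comp] at hfrac halg
  exact ⟨hweyl, htx, hty, htt, Set.forall_mem_image.2 hfrac, halg⟩

end Spread

theorem exists_isWeylGenerating_of_isoWeylField [CharZero k] {n : ℕ}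
    (h : IsoWeylField k n Z.s (SkewFrac (k ⊗[ℤ] AZ) (Z.oreDomain k))) :
    ∃ (X Y : Fin n → Z.Fraction k) (T : Fin Z.s → Z.Fraction k),
      IsWeylGenerating k (Z.toFraction k '' Z.genSet) (Z.toFraction k ∘ Z.x) X Y T := by
  obtain ⟨D, _, _, f, hf, ⟨e⟩⟩ := h
  obtain ⟨z, -, hz⟩ := Z.exists_algebraicIndependent_center k
  let e' : D ≃ₐ[k] Z.Fraction k := e.symm.trans (Z.fractionEquiv k)
  have hg : IsSkewFieldOfFractions
      ((e' : D →ₐ[k] Z.Fraction k).comp f : WeylAlgebraOver k n Z.s →+* Z.Fraction k) :=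
    hf.comp_ringEquiv e'.toRingEquiv
  exact ⟨_, _, _, isWeylGenerating_of_isSkewFieldOfFractions hg (Z.trdeg_center k) _
    fun i => (hz i ▸ (z i).2 : Z.toFraction k (Z.x i) ∈ _)⟩

theorem isoWeylField_of_isWeylGenerating [CharZero k] {n : ℕ} {X Y : Fin n → Z.Fraction k}
    {T : Fin Z.s → Z.Fraction k}
    (h : IsWeylGenerating k (Z.toFraction k '' Z.genSet) (Z.toFraction k ∘ Z.x) X Y T) :
    IsoWeylField k n Z.s (SkewFrac (k ⊗[ℤ] AZ) (Z.oreDomain k)) := by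
  obtain ⟨z, hz, z_eq⟩ := Z.exists_algebraicIndependent_center k
  obtain ⟨f, hf⟩ := h.exists_isSkewFieldOfFractions (Z.subfieldClosure_eq_top k) hz z_eq
  have := Z.small_fraction k
  exact isoWeylField_of_isSkewFieldOfFractions hf (Z.fractionEquiv k)

theorem tdeg_eq_finrank_gens : Tdeg k (SkewFrac (k ⊗[ℤ] AZ) (Z.oreDomain k)) =
    (Module.finrank ℤ Z.gens : EReal) := by
  have : Module.Finite ℤ Z.gens := Module.Finite.iff_fg.2 Z.gens_fg
  have := Z.filtr_free 1
  have gens_le : Z.gens ≤ filtr Z.gens 1 := le_layer_one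
  have : Module.IsTorsionFree ℤ Z.gens :=
    (Submodule.inclusion_injective gens_le).moduleIsTorsionFree
      (Submodule.inclusion gens_le) fun c x => map_smul _ c x
  rw [Z.tdeg_eq, Module.finrank_baseChange]

theorem gelfandKirillovHolds_iff [CharZero k] :
    GelfandKirillovHolds k (k ⊗[ℤ] AZ) (Z.oreDomain k) ↔
      ∃ n : ℕ, (Module.finrank ℤ Z.gens : EReal) = ((2 * n + Z.s : ℕ) : EReal) ∧
        IsoWeylField k n Z.s (SkewFrac (k ⊗[ℤ] AZ) (Z.oreDomain k)) := by
  rw [GelfandKirillovHolds, Z.trdeg_fractionRing_center k, Z.tdeg_eq_finrank_gens]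
  constructor
  · rintro ⟨n, l, htdeg, hl, hiso⟩
    obtain rfl : Z.s = l := Nat.cast_injective hl
    exact ⟨n, htdeg, hiso⟩
  · rintro ⟨n, htdeg, hiso⟩
    exact ⟨n, Z.s, htdeg, rfl, hiso⟩

theorem eventually_gelfandKirillovHolds [CharZero k]
    (h : GelfandKirillovHolds k (k ⊗[ℤ] AZ) (Z.oreDomain k)) :
    ∀ᶠ p in diagramFilter k,
      GelfandKirillovHolds p.carrier (p.carrier ⊗[ℤ] AZ) (Z.oreDomain p.carrier) := by
  obtain ⟨n, hn, hiso⟩ := Z.gelfandKirillovHolds_iff.1 h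
  obtain ⟨X, Y, T, hXYT⟩ := Z.exists_isWeylGenerating_of_isoWeylField hiso
  filter_upwards [Z.eventually_isWeylGenerating_spread hXYT] with p hp
  exact Z.gelfandKirillovHolds_iff.2 ⟨n, hn, Z.isoWeylField_of_isWeylGenerating hp⟩

end ZCompatible

/-! ### The existential sentence of a finite piece of a diagram -/

section Logic

open FirstOrder FirstOrder.Language

theorem isQF_iInf {L : Language} {α β : Type*} [Finite β] {n : ℕ}
    {f : β → L.BoundedFormula α n} (hf : ∀ b, (f b).IsQF) :
    (BoundedFormula.iInf f).IsQF := by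
  let _ := Fintype.ofFinite β
  change (((Finset.univ : Finset β).toList.map f).foldr (· ⊓ ·) ⊤).IsQF
  induction (Finset.univ : Finset β).toList with
  | nil => exact .top
  | cons b _ ih => exact (hf b).inf ih

/-- A ring as a structure for the symbols `0, 1, +, *`, by forgetting the negation of its structure
for Mathlib's language of rings. -/
abbrev arithStructure (R : Type*) [Ring R] : arithLang.Structure R :=
  letI := Ring.compatibleRingOfRing R
  arithToRing.reduct R

theorem models_ACF_iff (φ : arithLang.Sentence) (R : Type u) [Field R] [IsAlgClosed R]
    [CharZero R] :
    letI := arithStructure R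
    (Theory.ACF 0 ⊨ᵇ arithToRing.onSentence φ) ↔ R ⊨ φ := by
  let _ := Ring.compatibleRingOfRing R
  let _ := arithToRing.reduct R
  have := arithToRing.isExpansionOn_reduct R
  rw [← (Field.ACF_isComplete (.inr rfl)).realize_sentence_iff _ R, LHom.realize_onSentence]

namespace Literal

variable {k : Type u} [Field k] {N : ℕ} (ν : k → Fin N) (L : Literal k)

/-- The parameters of a literal. -/
def params : Literal k → Set k
  | one => {1}
  | add a b => {a, b, a + b}
  | mul a b => {a, b, a * b}
  | ne a => {a}

theorem finite_params : L.params.Finite := by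
  cases L <;> simp [params]

variable {L} in
theorem holds_congr {R : Type*} [Field R] {c c' : k → R} (h : Set.EqOn c c' L.params) :
    L.Holds c ↔ L.Holds c' := by
  cases L <;> simp_all [params, Holds, Set.EqOn]

/-- The literal as a quantifier-free formula, the parameter `a` being replaced by the variable
`ν a`. -/
def toFormula : Literal k → arithLang.BoundedFormula Empty N
  | one => Term.bdEqual (&(ν 1)) (Constants.term (ArithFunc.one : arithLang.Constants))
  | add a b => Term.bdEqual (&(ν (a + b)))
      (Functions.apply₂ (ArithFunc.add : arithLang.Functions 2) (&(ν a)) (&(ν b)))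
  | mul a b => Term.bdEqual (&(ν (a * b)))
      (Functions.apply₂ (ArithFunc.mul : arithLang.Functions 2) (&(ν a)) (&(ν b)))
  | ne a => ∼(Term.bdEqual (&(ν a)) (Constants.term (ArithFunc.zero : arithLang.Constants)))

theorem isQF_toFormula : (L.toFormula ν).IsQF := by
  cases L with
  | ne => exact (BoundedFormula.IsAtomic.equal _ _).isQF.not
  | _ => exact (BoundedFormula.IsAtomic.equal _ _).isQF

theorem realize_toFormula {R : Type*} [Field R] (v : Empty → R) (c : Fin N → R) :
    letI := arithStructure R
    (L.toFormula ν).Realize v c ↔ L.Holds (c ∘ ν) := by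
  cases L <;> exact Iff.rfl

end Literal

theorem exists_isQF_realize_exs_iff {k : Type u} [Field k] {S : Set (Literal k)} (hS : S.Finite) :
    ∃ (N : ℕ) (ψ : arithLang.BoundedFormula Empty N), ψ.IsQF ∧
      ∀ (R : Type u) [Field R], letI := arithStructure R
        (R ⊨ ψ.exs ↔ ∃ c : k → R, ∀ L ∈ S, L.Holds c) := by
  obtain ⟨N, a, -, range_a⟩ :=
    ((hS.biUnion fun L _ => L.finite_params).insert (0 : k)).fin_param
  have : Nonempty (Fin N) := Set.range_nonempty_iff_nonempty.1 (range_a ▸ Set.insert_nonempty _ _)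
  have : Finite S := hS
  let ν : k → Fin N := Function.invFun a
  have a_ν : ∀ L ∈ S, Set.EqOn (a ∘ ν) id L.params := fun L hL b hb =>
    Function.invFun_eq (range_a ▸ .inr (Set.mem_biUnion hL hb) : b ∈ Set.range a)
  refine ⟨N, .iInf fun L : S => L.1.toFormula ν, isQF_iInf fun L => L.1.isQF_toFormula ν, ?_⟩
  intro R _
  simp only [Sentence.Realize, BoundedFormula.realize_exs, BoundedFormula.realize_iInf,
    Literal.realize_toFormula, Subtype.forall]
  constructor
  · rintro ⟨c, hc⟩
    exact ⟨c ∘ ν, hc⟩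
  · rintro ⟨c, hc⟩
    exact ⟨c ∘ a, fun L hL =>
      (Literal.holds_congr fun b hb => congrArg c (a_ν L hL hb)).2 (hc L hL)⟩

theorem ZCompatible.exists_isQF_of_gelfandKirillovHolds {AZ : Type v} [Ring AZ]
    (Z : ZCompatible.{u, v} AZ) {k : Type u} [Field k] [IsAlgClosed k] [CharZero k]
    (h : GelfandKirillovHolds k (k ⊗[ℤ] AZ) (Z.oreDomain k)) :
    ∃ (N : ℕ) (ψ : arithLang.BoundedFormula Empty N), ψ.IsQF ∧
      (letI := arithStructure k; k ⊨ ψ.exs) ∧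
      ∀ (k' : Type u) [Field k'] [IsAlgClosed k'] [CharZero k'],
        (letI := arithStructure k'; k' ⊨ ψ.exs) →
          GelfandKirillovHolds k' (k' ⊗[ℤ] AZ) (Z.oreDomain k') := by
  obtain ⟨S, hS, holds_id, gk_of_holds⟩ :=
    exists_finite_literals_of_eventually (Z.eventually_gelfandKirillovHolds h)
  obtain ⟨N, ψ, hψ, realize_iff⟩ := exists_isQF_realize_exs_iff hS
  refine ⟨N, ψ, hψ, (realize_iff k).2 ⟨id, holds_id⟩, fun k' _ _ _ hk' => ?_⟩
  obtain ⟨c, hc⟩ := (realize_iff k').1 hk'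
  exact gk_of_holds ⟨k', c⟩ hc

end Logic

theorem exists_isAlgClosed_charZero :
    ∃ (k : Type u) (_ : Field k) (_ : IsAlgClosed k), CharZero k := by
  let e : ℚ ≃+* ULift.{u} ℚ := ULift.ringEquiv.symm
  exact ⟨AlgebraicClosure (ULift.{u} ℚ), inferInstance, inferInstance,
    charZero_of_injective_ringHom ((algebraMap _ _).comp e.toRingHom).injective⟩

end ZCompat

end

theorem mainTheorem2 (AZ : Type v) [Ring AZ] (K : ZCompat.ZCompatible.{u, v} AZ) :
    ∃ φ : ZCompat.arithLang.Sentence,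
      (∃ (N : ℕ) (ψ : ZCompat.arithLang.BoundedFormula Empty N), ψ.IsQF ∧ φ = ψ.exs) ∧
      List.TFAE [
        ∃ (k : Type u) (_ : Field k) (_ : IsAlgClosed k) (_ : CharZero k),
          ZCompat.GelfandKirillovHolds k (k ⊗[ℤ] AZ) (K.oreDomain k),
        ∀ (k : Type u) [Field k] [IsAlgClosed k] [CharZero k],
          ZCompat.GelfandKirillovHolds k (k ⊗[ℤ] AZ) (K.oreDomain k),
        FirstOrder.Language.Theory.ACF 0 ⊨ᵇ ZCompat.arithToRing.onSentence φ] := by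
  by_cases exists_gk : ∃ (k : Type u) (_ : Field k) (_ : IsAlgClosed k) (_ : CharZero k),
      ZCompat.GelfandKirillovHolds k (k ⊗[ℤ] AZ) (K.oreDomain k)
  · obtain ⟨k, _, _, _, hk⟩ := exists_gk
    obtain ⟨N, ψ, hψ, k_models, gk_of_models⟩ := K.exists_isQF_of_gelfandKirillovHolds hk
    have acf_models := (ZCompat.models_ACF_iff ψ.exs k).2 k_models
    refine ⟨ψ.exs, ⟨N, ψ, hψ, rfl⟩, ?_⟩
    tfae_have 1 → 3 := fun _ => acf_models
    tfae_have 3 → 2 := fun h k' _ _ _ => gk_of_models k' ((ZCompat.models_ACF_iff _ k').1 h)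
    tfae_have 2 → 1 := fun h => ⟨k, _, ‹_›, ‹_›, h k⟩
    tfae_finish
  · obtain ⟨k, _, _, _⟩ := ZCompat.exists_isAlgClosed_charZero.{u}
    refine ⟨⊥, ⟨0, ⊥, FirstOrder.Language.BoundedFormula.IsQF.falsum, rfl⟩, ?_⟩
    tfae_have 1 → 3 := fun h => absurd h exists_gk
    tfae_have 3 → 2 := fun h => ((ZCompat.models_ACF_iff ⊥ k).1 h).elim
    tfae_have 2 → 1 := fun h => ⟨k, _, ‹_›, ‹_›, h k⟩
    tfae_finish
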